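/- Let $(X,d)$ be a metric space and $x\in X$. Write $B(y,r)$ and $\overline B(y,r)$ for the open and closed balls, and for $E\subset X$ let $n(r,E)\in\{0,1,2,\dots,\infty\}$ be the minimum number of open balls of $X$ of radius $r$ needed to cover $E$. Dimensions take values in $[-\infty,+\infty]$, with $\log\infty=\infty$. The lower and upper tangential dimensions of $X$ at $x$ are $$\underline\delta_X(x)=\liminf_{\lambda\to0^+}\liminf_{r\to0^+}\frac{\log n(\lambda r,\overline B(x,r))}{\log 1/\lambda},\qquad \overline\delta_X(x)=\limsup_{\lambda\to0^+}\limsup_{r\to0^+}\frac{\log n(\lambda r,\overline B(x,r))}{\log 1/\lambda}.$$ The lower and upper box dimensions of a metric space $T$ with base point $p$ are $$\underline d(T)=\lim_{R\to\infty}\liminf_{r\to0^+}\frac{\log n(r,B_T(p,R))}{\log 1/r},\qquad \overline d(T)=\lim_{R\to\infty}\limsup_{r\to0^+}\frac{\log n(r,B_T(p,R))}{\log 1/r}.$$ For pointed metric spaces $(Y,y)$, $(Y',y')$ and $R>0$, let $d^R((Y,y),(Y',y'))$ be the infimum of the $\varepsilon>0$ for which there are isometric embeddings $\varphi,\varphi'$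 of $Y,Y'$ into a common metric space with $d(\varphi(y),\varphi'(y'))<\varepsilon$, such that $\varphi(\overline B_Y(y,R))$ lies in the open $\varepsilon$-neighbourhood of $\varphi'(Y')$ and $\varphi'(\overline B_{Y'}(y',R))$ lies in the open $\varepsilon$-neighbourhood of $\varphi(Y)$. The sets $\{(Y',y'): d^R((Y,y),(Y',y'))<\varepsilon\}$, with $R>0$ and $0<\varepsilon<1$, are the basic neighbourhoods of $(Y,y)$ in the pointed Gromov–Hausdorff topology. A tangent set of $X$ at $x$ is a proper pointed metric space $T$ that is a limit point of $(X,x,td)$ for $t\to\infty$ in this topology (every basic neighbourhood of $T$ contains $(X,x,td)$ for arbitrarily large $t$). Let $\mathcal T_xX$ be the family of tangent sets of $X$ at $x$. **Theorem.** Assume that (a) there are constants $c\ge1$ and $a\in(0,1]$ such that $n(\lambda\mu r,B(y,\lambda r))\le c\,n(\lambda\mu r,B(z,\lambda r))$ for all $0<r\le a$, all $0<\lambda,\mu\le1$ and all $y,z\in B(x,r)$; (b) $\limsup_{r\to0^+}n(\lambda r,\overline B(x,r))<\infty$ for every $\lambda>0$. Then $$\underline\delta_X(x)=\inf_{T\in\mathcal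 T_xX}\underline d(T)=\inf_{T\in\mathcal T_xX}\overline d(T),\qquad \overline\delta_X(x)=\sup_{T\in\mathcal T_xX}\underline d(T)=\sup_{T\in\mathcal T_xX}\overline d(T).$$ -/

import Mathlib

open Filter Topology
open scoped ENNReal NNReal

universe u

namespace TangentialDim

noncomputable section

/-- `n(r, E)`: the minimum number of open balls of radius `r` of the ambient metric space `X`
necessary to cover `E` (it is `⊤` if no finite number of balls suffices). -/
def coverNum {X : Type u} [MetricSpace X] (r : ℝ) (E : Set X) : ℕ∞ :=
  ⨅ (C : Set X) (_ : E ⊆ ⋃ c ∈ C, Metric.ball c r), C.encard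

theorem coverNum_mono {X : Type u} [MetricSpace X] (r : ℝ) {E F : Set X} (h : E ⊆ F) :
    coverNum r E ≤ coverNum r F :=
  iInf_mono fun _ => iInf_mono' fun hC => ⟨h.trans hC, le_rfl⟩

/-- `log n(r, E)`, with values in `[-∞, +∞]`; here `log ∞ = ∞`. -/
def logCoverNum {X : Type u} [MetricSpace X] (r : ℝ) (E : Set X) : EReal :=
  ENNReal.log ((coverNum r E : ℕ∞) : ℝ≥0∞)

/-- The lower tangential dimension of `X` at `x`. -/
def lowerTangentialDim {X : Type u} [MetricSpace X] (x : X) : EReal :=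
  liminf (fun l : ℝ => liminf (fun r : ℝ =>
    logCoverNum (l * r) (Metric.closedBall x r) / ((Real.log (1 / l) : ℝ) : EReal))
      (𝓝[>] 0)) (𝓝[>] 0)

/-- The upper tangential dimension of `X` at `x`. -/
def upperTangentialDim {X : Type u} [MetricSpace X] (x : X) : EReal :=
  limsup (fun l : ℝ => limsup (fun r : ℝ =>
    logCoverNum (l * r) (Metric.closedBall x r) / ((Real.log (1 / l) : ℝ) : EReal))
      (𝓝[>] 0)) (𝓝[>] 0)

/-- The lower box dimension of the ball `B(x, R)`, covered by balls of `X`. -/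
def lowerBallDim {X : Type u} [MetricSpace X] (x : X) (R : ℝ) : EReal :=
  liminf (fun r : ℝ =>
    logCoverNum r (Metric.ball x R) / ((Real.log (1 / r) : ℝ) : EReal)) (𝓝[>] 0)

/-- The upper box dimension of the ball `B(x, R)`, covered by balls of `X`. -/
def upperBallDim {X : Type u} [MetricSpace X] (x : X) (R : ℝ) : EReal :=
  limsup (fun r : ℝ =>
    logCoverNum r (Metric.ball x R) / ((Real.log (1 / r) : ℝ) : EReal)) (𝓝[>] 0)

/-- The lower box dimension of `X` (with reference point `x`): the limit of
`lowerBallDim x R` for `R → ∞`, which by monotonicity is the supremum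
(see `tendsto_lowerBallDim`). -/
def lowerBoxDim {X : Type u} [MetricSpace X] (x : X) : EReal :=
  ⨆ R : ℝ, lowerBallDim x R

/-- The upper box dimension of `X` (with reference point `x`): the limit of
`upperBallDim x R` for `R → ∞`, which by monotonicity is the supremum
(see `tendsto_upperBallDim`). -/
def upperBoxDim {X : Type u} [MetricSpace X] (x : X) : EReal :=
  ⨆ R : ℝ, upperBallDim x R

theorem eventually_quotient_mono {X : Type u} [MetricSpace X] (x : X) {R S : ℝ} (h : R ≤ S) :
    ∀ᶠ r : ℝ in 𝓝[>] 0,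
      logCoverNum r (Metric.ball x R) / ((Real.log (1 / r) : ℝ) : EReal) ≤
        logCoverNum r (Metric.ball x S) / ((Real.log (1 / r) : ℝ) : EReal) := by
  filter_upwards [Ioo_mem_nhdsGT (show (0 : ℝ) < 1 by norm_num)] with r hr
  have hpos : (0 : ℝ) ≤ Real.log (1 / r) :=
    Real.log_nonneg (by rw [le_div_iff₀ hr.1]; linarith [hr.2])
  refine EReal.div_le_div_right_of_nonneg (by exact_mod_cast hpos) ?_
  refine ENNReal.log_monotone ?_
  exact ENat.toENNReal_le.2 (coverNum_mono r (Metric.ball_subset_ball h))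

theorem tendsto_lowerBallDim {X : Type u} [MetricSpace X] (x : X) :
    Tendsto (lowerBallDim x) atTop (𝓝 (lowerBoxDim x)) :=
  tendsto_atTop_iSup fun _ _ h => liminf_le_liminf (eventually_quotient_mono x h)

theorem tendsto_upperBallDim {X : Type u} [MetricSpace X] (x : X) :
    Tendsto (upperBallDim x) atTop (𝓝 (upperBoxDim x)) :=
  tendsto_atTop_iSup fun _ _ h => limsup_le_limsup (eventually_quotient_mono x h)

/-- A pointed metric space. -/
structure PointedMetricSpace where
  /-- the underlying set -/
  carrier : Type u
  /-- the metric -/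
  [metric : MetricSpace carrier]
  /-- the base point -/
  pt : carrier

attribute [instance] PointedMetricSpace.metric

/-- The metric `t d` on `X`, for `t > 0`. -/
abbrev rescaledMetric (X : Type u) [MetricSpace X] (t : ℝ) (ht : 0 < t) : MetricSpace X where
  dist a b := t * dist a b
  dist_self a := by simp
  dist_comm a b := by rw [dist_comm]
  dist_triangle a b c := by
    rw [← mul_add]; exact mul_le_mul_of_nonneg_left (dist_triangle a b c) ht.le
  eq_of_dist_eq_zero := by
    intro a b h
    rcases mul_eq_zero.1 h with h | h
    · exact absurd h ht.ne'
    · exact dist_eq_zero.1 h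

/-- The pointed metric space `tX = (X, x, t d)`. -/
def rescale {X : Type u} [MetricSpace X] (x : X) (t : ℝ) (ht : 0 < t) :
    PointedMetricSpace.{u} :=
  letI := rescaledMetric X t ht
  ⟨X, x⟩

/-- `d^R((X, x), (Y, y)) ∈ [0, ∞]`: the infimum of the `ε > 0` such that `X` and `Y` embed
isometrically in a metric space `Z` in such a way that the base points are at distance `< ε`, the
closed `R`-ball of `X` is in the `ε`-neighbourhood of `Y`, and the closed `R`-ball of `Y` is in the
`ε`-neighbourhood of `X`. -/
def pGHDist (R : ℝ) (P Q : PointedMetricSpace.{u}) : ℝ≥0∞ :=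
  ⨅ (ε : ℝ) (_ : 0 < ε ∧ ∃ (Z : Type u) (_ : MetricSpace Z) (φ : P.carrier → Z)
      (ψ : Q.carrier → Z), Isometry φ ∧ Isometry ψ ∧ dist (φ P.pt) (ψ Q.pt) < ε ∧
      φ '' Metric.closedBall P.pt R ⊆ Metric.thickening ε (Set.range ψ) ∧
      ψ '' Metric.closedBall Q.pt R ⊆ Metric.thickening ε (Set.range φ)),
    ENNReal.ofReal ε

/-- The basic neighbourhood `V^{R,ε}` of `P` for the pointed Gromov-Hausdorff topology. -/
def pGHNhd (P : PointedMetricSpace.{u}) (R ε : ℝ) : Set PointedMetricSpace.{u} :=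
  {Q | pGHDist R P Q < ENNReal.ofReal ε}

/-- The tangent cone of `X` at `x`: the family of tangent sets, that is of the proper pointed
metric spaces `T` that are limit points, for `t → ∞`, of `tX` in the pointed Gromov-Hausdorff
topology (every basic neighbourhood of `T` contains `tX` for arbitrarily large `t`). -/
def tangentCone {X : Type u} [MetricSpace X] (x : X) : Set PointedMetricSpace.{u} :=
  {T | ProperSpace T.carrier ∧ ∀ R : ℝ, 0 < R → ∀ ε : ℝ, 0 < ε → ε < 1 →
    ∃ᶠ t : ℝ in atTop, ∃ ht : 0 < t, rescale x t ht ∈ pGHNhd T R ε}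

/-- The uniformity assumption on covering numbers of balls near `x`. -/
def UniformCovering {X : Type u} [MetricSpace X] (x : X) : Prop :=
  ∃ c : ℝ≥0, 1 ≤ c ∧ ∃ a : ℝ, 0 < a ∧ a ≤ 1 ∧
    ∀ r l m : ℝ, 0 < r → r ≤ a → 0 < l → l ≤ 1 → 0 < m → m ≤ 1 →
      ∀ y ∈ Metric.ball x r, ∀ z ∈ Metric.ball x r,
        ((coverNum (l * m * r) (Metric.ball y (l * r)) : ℕ∞) : ℝ≥0∞) ≤
          (c : ℝ≥0∞) * ((coverNum (l * m * r) (Metric.ball z (l * r)) : ℕ∞) : ℝ≥0∞)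

/-- For every `l > 0`, `limsup_{r → 0} n(l r, B̄(x, r)) < ∞`. -/
def FiniteCovering {X : Type u} [MetricSpace X] (x : X) : Prop :=
  ∀ l : ℝ, 0 < l →
    limsup (fun r : ℝ => coverNum (l * r) (Metric.closedBall x r)) (𝓝[>] 0) < ⊤

end

end TangentialDim

/-!
Let `Q r s` be the number of balls of radius `2⁻ˢ r` needed to cover the closed ball of radius `r`
at `x` (`dyadicCover`). These numbers are submultiplicative up to a constant:
`Q r (s + u) ≤ c * Q r s * Q (2⁻ˢ r) u`, because by the uniformity assumption balls with other
centers near `x` need at most `c` times as many balls as the ball at `x` (`dyadicCover_add_le`).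
Counting with separated points instead of covers, they are also supermultiplicative up to a
constant (`exists_dyadicCover_mul_le`).

Covering numbers of `T` and of `X` at a scale at which `X` is close to `T` bound each other. Hence
every tangent set has both box dimensions between the lower and the upper tangential dimension
(`lowerTangentialDim_le_lowerBoxDim`, `upperBoxDim_le_upperTangentialDim`).

For the converse let `α` be less than the upper tangential dimension. If every small scale `r` had
a descent of at most `H` steps with `c * Q r s ≤ 2 ^ (α s)`, then submultiplicativity, applied to a
concatenation of such descents, would bound the growth of `Q` by the rate `α` at all small scales,
and the upper tangential dimension would be at most `α`. So there are arbitrarily small scales `r`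
with `c * Q r s ≥ 2 ^ (α s)` for all `s ≤ H`; the constant does not depend on `H`
(`exists_scale_of_lt_upperTangentialDim`). Letting `H` tend to infinity, a limit of the
rescalings of `X` at these scales is a tangent set whose lower box dimension is at least `α`
(`exists_tangent_le_lowerBoxDim`). The lower tangential dimension is treated in the same way, with
supermultiplicativity (`exists_tangent_upperBoxDim_le`).

The limit exists by the finiteness assumption (`exists_limit`): it is the completion of the space of
bounded sequences in `X`, with the pseudometric obtained from the rescaled distances along a
nonprincipal ultrafilter. Finiteness provides uniform finite nets, which make the limit proper and
along which it is glued to the rescalings of `X` that are close to it.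
-/

namespace TangentialDim

/-! ### Covering numbers -/

section Covering

variable {X Y : Type u} [MetricSpace X] [MetricSpace Y]

theorem coverNum_le {r : ℝ} {E : Set X} (C : Set X) (h : E ⊆ ⋃ c ∈ C, Metric.ball c r) :
    coverNum r E ≤ C.encard :=
  iInf₂_le C h

theorem exists_encard_eq_coverNum {r : ℝ} {E : Set X} (h : coverNum r E ≠ ⊤) :
    ∃ C : Set X, E ⊆ (⋃ c ∈ C, Metric.ball c r) ∧ C.encard = coverNum r E ∧ C.Finite := by
  have h1 : coverNum r E = ⨅ C : {C : Set X // E ⊆ ⋃ c ∈ C, Metric.ball c r}, C.1.encard := by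
    rw [coverNum, iInf_subtype']
  have hne : Nonempty {C : Set X // E ⊆ ⋃ c ∈ C, Metric.ball c r} := by
    by_contra hcon
    rw [not_nonempty_iff] at hcon
    exact h (by rw [h1, iInf_of_empty])
  obtain ⟨C, hC⟩ := ciInf_mem
    (fun C : {C : Set X // E ⊆ ⋃ c ∈ C, Metric.ball c r} => C.1.encard)
  have hC' : C.1.encard = coverNum r E := by rw [h1]; exact hC
  exact ⟨C.1, C.2, hC', Set.encard_ne_top_iff.1 (hC' ▸ h)⟩

theorem one_le_coverNum {r : ℝ} {E : Set X} (h : E.Nonempty) : 1 ≤ coverNum r E := by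
  refine le_iInf₂ fun C hC => ?_
  obtain ⟨y, hy⟩ := h
  obtain ⟨c, hc, -⟩ := Set.mem_iUnion₂.1 (hC hy)
  exact Set.one_le_encard_iff_nonempty.2 ⟨c, hc⟩

theorem coverNum_empty (r : ℝ) : coverNum r (∅ : Set X) = 0 :=
  le_antisymm ((coverNum_le ∅ (Set.empty_subset _)).trans (by simp)) bot_le

theorem coverNum_union_le (r : ℝ) (E F : Set X) :
    coverNum r (E ∪ F) ≤ coverNum r E + coverNum r F := by
  by_cases hE : coverNum r E = ⊤
  · simp [hE]
  by_cases hF : coverNum r F = ⊤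
  · simp [hF]
  obtain ⟨C, hC, hC', -⟩ := exists_encard_eq_coverNum hE
  obtain ⟨D, hD, hD', -⟩ := exists_encard_eq_coverNum hF
  rw [← hC', ← hD']
  refine (coverNum_le (C ∪ D) ?_).trans (Set.encard_union_le C D)
  rw [Set.biUnion_union]
  exact Set.union_subset_union hC hD

theorem coverNum_biUnion_le {ι : Type*} (r : ℝ) (s : Finset ι) (F : ι → Set X) :
    coverNum r (⋃ i ∈ s, F i) ≤ ∑ i ∈ s, coverNum r (F i) := by
  classical
  induction s using Finset.induction_on with
  | empty => simp [coverNum_empty]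
  | insert i s hi ih =>
    rw [Finset.set_biUnion_insert, Finset.sum_insert hi]
    exact (coverNum_union_le r _ _).trans (by gcongr)

/-- Covering numbers are submultiplicative: a cover of `E` by balls of radius `r` is refined by
covering each of these balls by balls of radius `r'`. -/
theorem coverNum_le_mul {r r' : ℝ} {E : Set X} {b : ℕ∞} (hb : 1 ≤ b)
    (h : ∀ y, (Metric.ball y r ∩ E).Nonempty → coverNum r' (Metric.ball y r) ≤ b) :
    coverNum r' E ≤ coverNum r E * b := by
  classical
  by_cases hE : coverNum r E = ⊤
  · rw [hE, ENat.top_mul (by rintro rfl; simp at hb)]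
    exact le_top
  obtain ⟨C, hC, hC', hfin⟩ := exists_encard_eq_coverNum hE
  set s : Finset X := hfin.toFinset.filter fun y => (Metric.ball y r ∩ E).Nonempty with hs
  have hcov : E ⊆ ⋃ y ∈ s, Metric.ball y r := by
    intro z hz
    obtain ⟨y, hy, hzy⟩ := Set.mem_iUnion₂.1 (hC hz)
    refine Set.mem_iUnion₂.2 ⟨y, ?_, hzy⟩
    simp only [hs, Finset.mem_filter, Set.Finite.mem_toFinset]
    exact ⟨hy, z, hzy, hz⟩
  calc coverNum r' E ≤ coverNum r' (⋃ y ∈ s, Metric.ball y r) := coverNum_mono r' hcov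
    _ ≤ ∑ y ∈ s, coverNum r' (Metric.ball y r) := coverNum_biUnion_le _ _ _
    _ ≤ ∑ _y ∈ s, b := Finset.sum_le_sum fun y hy => h y (Finset.mem_filter.1 hy).2
    _ = s.card * b := by simp
    _ ≤ coverNum r E * b := by
      gcongr
      rw [← hC', hfin.encard_eq_coe_toFinset_card]
      exact_mod_cast Finset.card_filter_le _ _

/-- Since fewer than `n(r, E)` balls of radius `r` cannot cover `E`, an `r`-separated subset of `E`
can be enlarged until it has `n(r, E)` points. -/
theorem exists_separated {r : ℝ} (hr : 0 < r) {E : Set X} {m : ℕ} (hm : (m : ℕ∞) ≤ coverNum r E) :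
    ∃ Y : Finset X, ↑Y ⊆ E ∧ Y.card = m ∧ ∀ y ∈ Y, ∀ z ∈ Y, y ≠ z → r ≤ dist y z := by
  classical
  induction m with
  | zero => exact ⟨∅, by simp⟩
  | succ m ih =>
    obtain ⟨Y, hYE, hcard, hsep⟩ := ih (le_trans (by exact_mod_cast Nat.le_succ m) hm)
    have hncov : ¬ E ⊆ ⋃ c ∈ (Y : Set X), Metric.ball c r := by
      intro hcov
      have h1 := hm.trans (coverNum_le _ hcov)
      rw [Set.encard_coe_eq_coe_finsetCard, hcard] at h1
      have : m + 1 ≤ m := by exact_mod_cast h1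
      omega
    obtain ⟨z, hzE, hz⟩ := Set.not_subset.1 hncov
    have hz' : ∀ y ∈ Y, r ≤ dist z y := by
      intro y hy
      by_contra hlt
      exact hz (Set.mem_iUnion₂.2 ⟨y, hy, Metric.mem_ball.2 (not_le.1 hlt)⟩)
    have hzY : z ∉ Y := fun hzY => by simpa using hr.trans_le (hz' z hzY)
    refine ⟨insert z Y, ?_, ?_, ?_⟩
    · rw [Finset.coe_insert]
      exact Set.insert_subset hzE hYE
    · rw [Finset.card_insert_of_notMem hzY, hcard]
    · intro y hy w hw hne
      rcases Finset.mem_insert.1 hy with rfl | hy'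
      · rcases Finset.mem_insert.1 hw with rfl | hw'
        · exact absurd rfl hne
        · exact hz' w hw'
      · rcases Finset.mem_insert.1 hw with rfl | hw'
        · rw [dist_comm]; exact hz' y hy'
        · exact hsep y hy' w hw' hne

/-- Covering numbers are supermultiplicative, up to a change of scale: balls around the points of a
separated subset of `E` have disjoint sets of balls covering them. -/
theorem coverNum_mul_le {r r' s : ℝ} {E F : Set X} {b c : ℕ∞} (hs : 0 < s)
    (hrs : 2 * r + 2 * r' ≤ s) (hEF : ∀ y ∈ E, Metric.ball y r ⊆ F)
    (hfin : coverNum s E ≠ ⊤) (h : ∀ y ∈ E, b ≤ c * coverNum r' (Metric.ball y r)) :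
    coverNum s E * b ≤ c * coverNum r' F := by
  classical
  by_cases hF : coverNum r' F = ⊤
  · by_cases hc : c = 0
    · subst hc
      by_cases hb : b = 0
      · simp [hb]
      · have hE : E = ∅ := by
          by_contra hne
          obtain ⟨y, hy⟩ := Set.nonempty_iff_ne_empty.2 hne
          exact hb (by simpa using h y hy)
        simp [hE, coverNum_empty]
    · rw [hF, ENat.mul_top hc]
      exact le_top
  obtain ⟨C, hC, hC', hCfin⟩ := exists_encard_eq_coverNum hF
  obtain ⟨m, hm⟩ := ENat.ne_top_iff_exists.1 hfin
  obtain ⟨Y, hYE, hcard, hsep⟩ := exists_separated hs hm.le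
  -- the centers of the balls of the cover that meet the ball at `y`
  set D : X → Finset X := fun y =>
    hCfin.toFinset.filter fun c => (Metric.ball c r' ∩ Metric.ball y r).Nonempty with hD
  have hDcov : ∀ y ∈ Y, coverNum r' (Metric.ball y r) ≤ ((D y).card : ℕ∞) := by
    intro y hy
    rw [← Set.encard_coe_eq_coe_finsetCard]
    refine coverNum_le _ fun z hz => ?_
    obtain ⟨c, hc, hzc⟩ := Set.mem_iUnion₂.1 (hC (hEF y (hYE hy) hz))
    refine Set.mem_iUnion₂.2 ⟨c, ?_, hzc⟩
    simp only [hD, Finset.coe_filter, Set.Finite.mem_toFinset, Set.mem_ofPred_eq]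
    exact ⟨hc, z, hzc, hz⟩
  have hdisj : (Y : Set X).PairwiseDisjoint D := by
    intro y hy z hz hne
    refine Finset.disjoint_left.2 fun c hcy hcz => ?_
    obtain ⟨p, hp1, hp2⟩ := (Finset.mem_filter.1 hcy).2
    obtain ⟨q, hq1, hq2⟩ := (Finset.mem_filter.1 hcz).2
    have := hsep y hy z hz hne
    rw [Metric.mem_ball] at hp1 hp2 hq1 hq2
    have h1 := dist_triangle4 y p c q
    have h2 := dist_triangle y q z
    rw [dist_comm y p] at h1
    rw [dist_comm c q] at h1
    linarith
  calc coverNum s E * b = ∑ _y ∈ Y, b := by rw [← hm, ← hcard]; simp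
    _ ≤ ∑ y ∈ Y, c * ((D y).card : ℕ∞) := Finset.sum_le_sum fun y hy =>
        (h y (hYE hy)).trans (by gcongr; exact hDcov y hy)
    _ = c * (Y.biUnion D).card := by
        rw [Finset.card_biUnion (fun y hy z hz hne => hdisj hy hz hne), Nat.cast_sum,
          Finset.mul_sum]
    _ ≤ c * coverNum r' F := by
        gcongr
        rw [← hC', hCfin.encard_eq_coe_toFinset_card]
        exact_mod_cast Finset.card_le_card (Finset.biUnion_subset.2 fun y _ =>
          Finset.filter_subset _ _)

/-- Covering numbers of `F` bound those of `E` when the points of `E` have companions in `F` such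
that companions in a common ball of radius `r` come from points at distance less than `s`. -/
theorem coverNum_le_of_rel {r s : ℝ} {E : Set X} {F : Set Y} (R : X → Y → Prop)
    (hEF : ∀ p ∈ E, ∃ q ∈ F, R p q)
    (hdist : ∀ p p' q q', R p q → R p' q' → dist q q' < 2 * r → dist p p' < s) :
    coverNum s E ≤ coverNum r F := by
  rcases E.eq_empty_or_nonempty with rfl | ⟨p₀, hp₀⟩
  · simp [coverNum_empty]
  have : Nonempty X := ⟨p₀⟩
  have : Nonempty Y := ⟨(hEF p₀ hp₀).choose⟩
  refine le_iInf₂ fun C hC => ?_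
  -- for every ball of the cover of `F`, a point of `E` with a companion in it
  set C' : Set Y := {c ∈ C | ∃ p ∈ E, ∃ q, R p q ∧ dist q c < r} with hC'
  have hch : ∀ c ∈ C', ∃ p ∈ E, ∃ q, R p q ∧ dist q c < r := fun c hc => hc.2
  choose! f _ q hR hq using hch
  refine (coverNum_le (f '' C') ?_).trans ((Set.encard_image_le f _).trans
    (Set.encard_le_encard fun c hc => hc.1))
  intro p hp
  obtain ⟨q', hq'F, hpq'⟩ := hEF p hp
  obtain ⟨c, hc, hcq⟩ := Set.mem_iUnion₂.1 (hC hq'F)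
  have hcC' : c ∈ C' := ⟨hc, p, hp, q', hpq', hcq⟩
  refine Set.mem_iUnion₂.2 ⟨f c, ⟨c, hcC', rfl⟩, ?_⟩
  refine hdist p (f c) q' (q c) hpq' (hR c hcC') ?_
  have := dist_triangle_right q' (q c) c
  have h2 := hq c hcC'
  rw [Metric.mem_ball] at hcq
  linarith

theorem coverNum_anti {r s : ℝ} (h : r ≤ s) (E : Set X) : coverNum s E ≤ coverNum r E :=
  iInf_mono fun _ => iInf_mono' fun hC =>
    ⟨hC.trans (Set.iUnion₂_mono fun _ _ => Metric.ball_subset_ball h), le_rfl⟩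

end Covering

/-! ### Dyadic covering numbers of small balls -/

section Dyadic

variable {X : Type u} [MetricSpace X] {x : X}

/-- The uniformity assumption with an integral constant and with the radii as parameters. -/
theorem UniformCovering.exists_nat (h : UniformCovering x) :
    ∃ c : ℕ, 1 ≤ c ∧ ∃ a : ℝ, 0 < a ∧ ∀ r s t : ℝ, 0 < r → r ≤ a → s ≤ r → 0 < t → t ≤ s →
      ∀ y ∈ Metric.ball x r, ∀ z ∈ Metric.ball x r,
        coverNum t (Metric.ball y s) ≤ c * coverNum t (Metric.ball z s) := by
  obtain ⟨c, hc, a, ha, -, h⟩ := h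
  refine ⟨⌈c⌉₊, Nat.one_le_ceil_iff.2 (zero_lt_one.trans_le hc), a, ha, ?_⟩
  intro r s t hr hra hsr ht hts y hy z hz
  have hs : 0 < s := ht.trans_le hts
  have := h r (s / r) (t / s) hr hra (by positivity) (by rwa [div_le_one hr]) (by positivity)
    (by rwa [div_le_one hs]) y hy z hz
  rw [div_mul_cancel₀ _ hr.ne', show s / r * (t / s) * r = t by field_simp] at this
  rw [← ENat.toENNReal_le, ENat.toENNReal_mul]
  refine this.trans ?_
  gcongr
  simp only [ENat.toENNReal_coe]
  exact_mod_cast Nat.le_ceil c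

/-- The number of balls of radius `2⁻ˢ r` needed to cover the closed ball of radius `r` at `x`. -/
noncomputable def dyadicCover (x : X) (r : ℝ) (s : ℕ) : ℕ∞ :=
  coverNum ((1 / 2 : ℝ) ^ s * r) (Metric.closedBall x r)

theorem one_le_dyadicCover {r : ℝ} (hr : 0 < r) (s : ℕ) : 1 ≤ dyadicCover x r s :=
  one_le_coverNum ⟨x, Metric.mem_closedBall_self hr.le⟩

theorem dyadicCover_mono {r : ℝ} (hr : 0 < r) : Monotone (dyadicCover x r) := fun s t h =>
  coverNum_anti (mul_le_mul_of_nonneg_right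
    (pow_le_pow_of_le_one (by norm_num) (by norm_num) h) hr.le) _

theorem FiniteCovering.eventually_le (h : FiniteCovering x) {l : ℝ} (hl : 0 < l) :
    ∃ K : ℕ, ∃ r₀ : ℝ, 0 < r₀ ∧ ∀ r, 0 < r → r < r₀ →
      coverNum (l * r) (Metric.closedBall x r) ≤ K := by
  obtain ⟨N, hN⟩ := ENat.ne_top_iff_exists.1 (h l hl).ne
  have hlt : limsup (fun r : ℝ => coverNum (l * r) (Metric.closedBall x r)) (𝓝[>] 0)
      < ((N + 1 : ℕ) : ℕ∞) := by
    rw [← hN]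
    exact_mod_cast Nat.lt_succ_self N
  obtain ⟨r₀, hr₀, hsub⟩ := mem_nhdsGT_iff_exists_Ioo_subset.1 (eventually_lt_of_limsup_lt hlt)
  exact ⟨N + 1, r₀, hr₀, fun r h0 h1 => (hsub ⟨h0, h1⟩ : _ < _).le⟩

theorem FiniteCovering.dyadicCover_le (h : FiniteCovering x) (j : ℕ) :
    ∃ K : ℕ, ∃ r₀ : ℝ, 0 < r₀ ∧ ∀ r, 0 < r → r < r₀ → dyadicCover x r j ≤ K :=
  h.eventually_le (by positivity)

/-- Under the uniformity assumption, dyadic covering numbers are submultiplicative up to the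
constant of that assumption. -/
theorem dyadicCover_add_le {c : ℕ} {a : ℝ} (hc : 1 ≤ c)
    (h : ∀ r s t : ℝ, 0 < r → r ≤ a → s ≤ r → 0 < t → t ≤ s →
      ∀ y ∈ Metric.ball x r, ∀ z ∈ Metric.ball x r,
        coverNum t (Metric.ball y s) ≤ c * coverNum t (Metric.ball z s))
    {r : ℝ} (hr : 0 < r) (hra : 2 * r ≤ a) (s u : ℕ) :
    dyadicCover x r (s + u) ≤ c * dyadicCover x r s * dyadicCover x ((1 / 2 : ℝ) ^ s * r) u := by
  have hs : (1 / 2 : ℝ) ^ s ≤ 1 := pow_le_one₀ (by norm_num) (by norm_num)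
  have hu : (1 / 2 : ℝ) ^ u ≤ 1 := pow_le_one₀ (by norm_num) (by norm_num)
  have hsr : (1 / 2 : ℝ) ^ s * r ≤ r := by nlinarith
  have hs0 : 0 < (1 / 2 : ℝ) ^ s * r := by positivity
  have hb : (1 : ℕ∞) ≤ c * dyadicCover x ((1 / 2 : ℝ) ^ s * r) u :=
    one_le_mul (by exact_mod_cast hc) (one_le_dyadicCover hs0 u)
  rw [mul_comm (c : ℕ∞), mul_assoc]
  refine coverNum_le_mul hb fun y ⟨z, hzy, hzx⟩ => ?_
  rw [Metric.mem_ball] at hzy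
  rw [Metric.mem_closedBall] at hzx
  have hyx : y ∈ Metric.ball x (2 * r) := by
    rw [Metric.mem_ball]
    linarith [dist_triangle_left y x z]
  have key := h (2 * r) ((1 / 2 : ℝ) ^ s * r) ((1 / 2 : ℝ) ^ (s + u) * r) (by positivity) hra
    (by linarith) (by positivity) (by rw [pow_add]; nlinarith) y hyx x
    (Metric.mem_ball_self (by positivity))
  refine key.trans ?_
  gcongr
  rw [dyadicCover, ← mul_assoc, ← pow_add, add_comm u s]
  exact coverNum_mono _ Metric.ball_subset_closedBall

/-- The threshold for `r` below which all dyadic covering numbers are finite does not depend on the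
number of steps. -/
theorem dyadicCover_ne_top {c K : ℕ} {a r₁ : ℝ} (hc : 1 ≤ c)
    (h : ∀ r s t : ℝ, 0 < r → r ≤ a → s ≤ r → 0 < t → t ≤ s →
      ∀ y ∈ Metric.ball x r, ∀ z ∈ Metric.ball x r,
        coverNum t (Metric.ball y s) ≤ c * coverNum t (Metric.ball z s))
    (hK : ∀ r, 0 < r → r < r₁ → dyadicCover x r 1 ≤ K) (s : ℕ) :
    ∀ r, 0 < r → r < r₁ → 2 * r ≤ a → dyadicCover x r s ≠ ⊤ := by
  induction s with
  | zero =>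
    intro r hr hlt _
    exact ne_top_of_le_ne_top (ENat.natCast_ne_top K)
      ((dyadicCover_mono hr zero_le_one).trans (hK r hr hlt))
  | succ s ih =>
    intro r hr hlt hra
    have h1 := dyadicCover_add_le hc h hr hra 1 s
    rw [add_comm 1 s] at h1
    refine ne_top_of_le_ne_top ?_ h1
    refine WithTop.mul_ne_top (WithTop.mul_ne_top (ENat.natCast_ne_top c)
      (ne_top_of_le_ne_top (ENat.natCast_ne_top K) (hK r hr hlt))) (ih _ (by positivity) ?_ ?_)
    · linarith
    · linarith

/-- Under both assumptions, dyadic covering numbers are supermultiplicative up to a constant. -/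
theorem exists_dyadicCover_mul_le (hunif : UniformCovering x) (hfin : FiniteCovering x) :
    ∃ c : ℕ, 1 ≤ c ∧ ∃ r₀ : ℝ, 0 < r₀ ∧ ∀ r, 0 < r → r < r₀ → ∀ s u : ℕ,
      dyadicCover x r s * dyadicCover x ((1 / 2 : ℝ) ^ s * r) u ≤ c * dyadicCover x r (s + u) := by
  obtain ⟨c, hc, a, ha, h⟩ := hunif.exists_nat
  obtain ⟨K₁, r₁, hr₁, hK₁⟩ := hfin.dyadicCover_le 1
  obtain ⟨K₃, r₃, hr₃, hK₃⟩ := hfin.dyadicCover_le 3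
  obtain ⟨K₄, r₄, hr₄, hK₄⟩ := hfin.dyadicCover_le 4
  refine ⟨c ^ 3 * K₁ * K₃ + K₄ + 1, by omega, min (min r₁ r₃) (min r₄ (a / 2)), by positivity, ?_⟩
  intro r hr hlt s u
  simp only [lt_min_iff] at hlt
  obtain ⟨⟨hl₁, hl₃⟩, hl₄, hla⟩ := hlt
  have hs1 : (1 / 2 : ℝ) ^ s ≤ 1 := pow_le_one₀ (by norm_num) (by norm_num)
  have hu1 : (1 / 2 : ℝ) ^ u ≤ 1 := pow_le_one₀ (by norm_num) (by norm_num)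
  have hu0 : (0 : ℝ) < (1 / 2 : ℝ) ^ u := by positivity
  -- the separated balls used for `s ≥ 4` have radius `2 * 2⁻ˢ * r`, and their centers fill the ball
  -- of radius `r / 2`, so that they stay in the ball of radius `r`
  rcases lt_or_ge s 4 with hs | hs
  · have h1 : dyadicCover x ((1 / 2 : ℝ) ^ s * r) u ≤ dyadicCover x r (s + u) := by
      rw [dyadicCover, ← mul_assoc, ← pow_add, add_comm u s]
      exact coverNum_mono _ (Metric.closedBall_subset_closedBall (by nlinarith))
    have h2 : dyadicCover x r s ≤ K₄ := (dyadicCover_mono hr hs.le).trans (hK₄ r hr hl₄)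
    refine mul_le_mul' (h2.trans ?_) h1
    exact_mod_cast (by omega : K₄ ≤ c ^ 3 * K₁ * K₃ + K₄ + 1)
  · obtain ⟨s, rfl⟩ := Nat.exists_eq_add_of_le' hs
    have hs0 : (0 : ℝ) < (1 / 2 : ℝ) ^ s := by positivity
    have hs2 : (1 / 2 : ℝ) ^ s ≤ 1 := pow_le_one₀ (by norm_num) (by norm_num)
    have hpow : (1 / 2 : ℝ) ^ (s + 4) = (1 / 2 : ℝ) ^ s / 16 := by rw [pow_add]; norm_num; ring
    have hle1 : (1 / 2 : ℝ) ^ s * (r / 2) < r₃ := by nlinarith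
    -- replace the scale `2⁻ˢ⁻⁴` by the coarser scale at which separated balls are used
    have hcoarse : dyadicCover x r (s + 4) ≤ c ^ 2 * K₁ * K₃ * dyadicCover x (r / 2) s := by
      have e1 := dyadicCover_add_le hc h hr (by linarith) 1 (s + 3)
      have e2 := dyadicCover_add_le hc h (half_pos hr) (by linarith) s 3
      rw [show 1 + (s + 3) = s + 4 by ring, pow_one, show 1 / 2 * r = r / 2 by ring] at e1
      calc dyadicCover x r (s + 4)
          ≤ c * dyadicCover x r 1 * dyadicCover x (r / 2) (s + 3) := e1
        _ ≤ c * K₁ * (c * dyadicCover x (r / 2) s * K₃) := by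
          gcongr
          · exact hK₁ r hr hl₁
          · refine e2.trans ?_
            gcongr
            exact hK₃ _ (by positivity) hle1
        _ = c ^ 2 * K₁ * K₃ * dyadicCover x (r / 2) s := by ring
    have hne : dyadicCover x (r / 2) s ≠ ⊤ :=
      dyadicCover_ne_top hc h hK₁ s _ (half_pos hr) (by linarith) (by linarith)
    have hsep : dyadicCover x (r / 2) s * dyadicCover x ((1 / 2 : ℝ) ^ (s + 4) * r) u
        ≤ c * dyadicCover x r (s + 4 + u) := by
      refine (mul_le_mul' le_rfl ?_).trans (coverNum_mul_le
        (r := 2 * (1 / 2 : ℝ) ^ (s + 4) * r) (r' := (1 / 2 : ℝ) ^ (s + 4 + u) * r)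
        (b := coverNum ((1 / 2 : ℝ) ^ (s + 4 + u) * r)
          (Metric.ball x (2 * (1 / 2 : ℝ) ^ (s + 4) * r)))
        (by positivity) ?_ ?_ hne ?_)
      · rw [dyadicCover, ← mul_assoc, ← pow_add, add_comm u]
        refine coverNum_mono _ (Metric.closedBall_subset_ball ?_)
        have : 0 < (1 / 2 : ℝ) ^ (s + 4) * r := by positivity
        linarith
      · rw [pow_add _ (s + 4) u, hpow]
        nlinarith [mul_pos hs0 hr, mul_le_mul_of_nonneg_left hu1 (mul_pos hs0 hr).le]
      · intro y hy z hz
        rw [Metric.mem_closedBall] at *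
        rw [Metric.mem_ball, hpow] at hz
        have := dist_triangle z y x
        nlinarith
      · intro y hy
        refine h r _ _ hr (by linarith) ?_ (by positivity) ?_ x (Metric.mem_ball_self hr) y
          (Metric.closedBall_subset_ball (by linarith) hy)
        · rw [hpow]; nlinarith
        · rw [pow_add _ (s + 4) u, hpow]
          nlinarith [mul_pos hs0 hr, mul_le_mul_of_nonneg_left hu1 (mul_pos hs0 hr).le]
    calc dyadicCover x r (s + 4) * dyadicCover x ((1 / 2 : ℝ) ^ (s + 4) * r) u
        ≤ c ^ 2 * K₁ * K₃ * dyadicCover x (r / 2) s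
            * dyadicCover x ((1 / 2 : ℝ) ^ (s + 4) * r) u := by gcongr
      _ ≤ c ^ 2 * K₁ * K₃ * (c * dyadicCover x r (s + 4 + u)) := by rw [mul_assoc]; gcongr
      _ = (c ^ 3 * K₁ * K₃) * dyadicCover x r (s + 4 + u) := by ring
      _ ≤ _ := by
        gcongr
        exact_mod_cast (by omega : c ^ 3 * K₁ * K₃ ≤ c ^ 3 * K₁ * K₃ + K₄ + 1)

end Dyadic

/-! ### Selection of good scales -/

section Greedy

variable {q : ℝ → ℕ → ℝ≥0∞} {c A K : ℝ≥0∞} {r₀ : ℝ} {H : ℕ}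

theorem half_pow_mul_mem {r : ℝ} (hr : 0 < r) (hlt : r < r₀) (s : ℕ) :
    0 < (1 / 2 : ℝ) ^ s * r ∧ (1 / 2 : ℝ) ^ s * r < r₀ := by
  have hs : (1 / 2 : ℝ) ^ s ≤ 1 := pow_le_one₀ (by norm_num) (by norm_num)
  exact ⟨by positivity, by nlinarith⟩

/-- If from every small scale `r` one can descend by some `s ≤ H` steps with growth at most `Aˢ`,
the constant `c` of submultiplicativity included, then concatenating such descents bounds the
growth over any number of steps. -/
theorem le_mul_pow_of_forall_exists (hA : A ≠ 0) (hA' : A ≠ ⊤)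
    (hsub : ∀ r, 0 < r → r < r₀ → ∀ s u, q r (s + u) ≤ c * q r s * q ((1 / 2 : ℝ) ^ s * r) u)
    (hK : ∀ r, 0 < r → r < r₀ → ∀ s ≤ H, q r s ≤ K)
    (h : ∀ r, 0 < r → r < r₀ → ∃ s, 1 ≤ s ∧ s ≤ H ∧ c * q r s ≤ A ^ s) (n : ℕ) :
    ∀ r, 0 < r → r < r₀ → q r n ≤ K * (1 + A⁻¹) ^ H * A ^ n := by
  induction n using Nat.strong_induction_on with
  | _ n ih =>
  intro r hr hlt
  rcases le_or_gt n H with hn | hn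
  · -- the factor `(1 + A⁻¹) ^ H` compensates for `A ^ n` being small when `A < 1`
    have h1 : (1 : ℝ≥0∞) ≤ (1 + A⁻¹) ^ H * A ^ n := by
      calc (1 : ℝ≥0∞) ≤ ((1 + A⁻¹) * A) ^ n := by
            refine one_le_pow₀ ?_
            rw [add_mul, ENNReal.inv_mul_cancel hA hA']
            exact le_add_self
        _ = (1 + A⁻¹) ^ n * A ^ n := mul_pow _ _ _
        _ ≤ (1 + A⁻¹) ^ H * A ^ n := by
            gcongr
            exact le_self_add
    calc q r n ≤ K * 1 := by rw [mul_one]; exact hK r hr hlt n hn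
      _ ≤ K * ((1 + A⁻¹) ^ H * A ^ n) := by gcongr
      _ = _ := (mul_assoc _ _ _).symm
  · obtain ⟨s, hs1, hsH, hs⟩ := h r hr hlt
    obtain ⟨u, rfl⟩ := Nat.exists_eq_add_of_le (hsH.trans hn.le)
    obtain ⟨h0, h1⟩ := half_pow_mul_mem hr hlt s
    calc q r (s + u) ≤ c * q r s * q ((1 / 2 : ℝ) ^ s * r) u := hsub r hr hlt s u
      _ ≤ A ^ s * (K * (1 + A⁻¹) ^ H * A ^ u) := by
        gcongr
        exact ih u (by omega) _ h0 h1
      _ = _ := by rw [pow_add]; ring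

/-- The counterpart of `le_mul_pow_of_forall_exists` for lower bounds. -/
theorem pow_le_mul_of_forall_exists (hc : c ≠ 0) (hc' : c ≠ ⊤)
    (hsup : ∀ r, 0 < r → r < r₀ → ∀ s u, q r s * q ((1 / 2 : ℝ) ^ s * r) u ≤ c * q r (s + u))
    (h1 : ∀ r, 0 < r → r < r₀ → ∀ s, 1 ≤ q r s)
    (h : ∀ r, 0 < r → r < r₀ → ∃ s, 1 ≤ s ∧ s ≤ H ∧ c * A ^ s ≤ q r s) (n : ℕ) :
    ∀ r, 0 < r → r < r₀ → A ^ n ≤ (1 + A) ^ H * q r n := by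
  induction n using Nat.strong_induction_on with
  | _ n ih =>
  intro r hr hlt
  rcases le_or_gt n H with hn | hn
  · calc A ^ n ≤ (1 + A) ^ n := by gcongr; exact le_add_self
      _ ≤ (1 + A) ^ H := by gcongr; exact le_self_add
      _ ≤ (1 + A) ^ H * q r n := le_mul_of_one_le_right' (h1 r hr hlt n)
  · obtain ⟨s, hs1, hsH, hs⟩ := h r hr hlt
    obtain ⟨u, rfl⟩ := Nat.exists_eq_add_of_le (hsH.trans hn.le)
    obtain ⟨h0, h2⟩ := half_pow_mul_mem hr hlt s
    refine (ENNReal.mul_le_mul_iff_right hc hc').1 ?_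
    calc c * A ^ (s + u) = c * A ^ s * A ^ u := by rw [pow_add]; ring
      _ ≤ q r s * ((1 + A) ^ H * q ((1 / 2 : ℝ) ^ s * r) u) := by
        gcongr
        exact ih u (by omega) _ h0 h2
      _ = (1 + A) ^ H * (q r s * q ((1 / 2 : ℝ) ^ s * r) u) := by ring
      _ ≤ (1 + A) ^ H * (c * q r (s + u)) := mul_le_mul' le_rfl (hsup r hr hlt s u)
      _ = _ := by ring

end Greedy

/-! ### Logarithmic growth rates -/

section Rates

variable {l M α : ℝ} {N C : ℝ≥0∞}

theorem log_one_div_pos (hl : 0 < l) (hl1 : l < 1) : 0 < Real.log (1 / l) :=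
  Real.log_pos (by rwa [lt_div_iff₀ hl, one_mul])

theorem log_ofReal_mul_rpow (hl : 0 < l) (hl1 : l < 1) (hM : 0 < M) :
    ENNReal.log (ENNReal.ofReal (M * l ^ (-α))) =
      ((Real.log (1 / l) * (α + Real.log M / Real.log (1 / l)) : ℝ) : EReal) := by
  have hlog := log_one_div_pos hl hl1
  rw [ENNReal.log_ofReal_of_pos (by positivity), Real.log_mul hM.ne' (by positivity),
    Real.log_rpow hl, mul_add, mul_div_cancel₀ _ hlog.ne', Real.log_div one_ne_zero hl.ne',
    Real.log_one]
  congr 1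
  ring

theorem log_div_le_iff (hl : 0 < l) (hl1 : l < 1) (hM : 0 < M) :
    ENNReal.log N / ((Real.log (1 / l) : ℝ) : EReal) ≤
        ((α + Real.log M / Real.log (1 / l) : ℝ) : EReal) ↔
      N ≤ ENNReal.ofReal (M * l ^ (-α)) := by
  rw [EReal.div_le_iff_le_mul (by exact_mod_cast log_one_div_pos hl hl1) (EReal.coe_ne_top _),
    ← EReal.coe_mul, ← log_ofReal_mul_rpow hl hl1 hM, ENNReal.log_le_log_iff]

theorem le_log_div_iff (hl : 0 < l) (hl1 : l < 1) (hM : 0 < M) :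
    ((α + Real.log M / Real.log (1 / l) : ℝ) : EReal) ≤
        ENNReal.log N / ((Real.log (1 / l) : ℝ) : EReal) ↔
      ENNReal.ofReal (M * l ^ (-α)) ≤ N := by
  rw [EReal.le_div_iff_mul_le (by exact_mod_cast log_one_div_pos hl hl1) (EReal.coe_ne_top _),
    ← EReal.coe_mul, mul_comm, ← log_ofReal_mul_rpow hl hl1 hM, ENNReal.log_le_log_iff]

theorem le_rpow_of_log_div_le (hl : 0 < l) (hl1 : l < 1)
    (h : ENNReal.log N / ((Real.log (1 / l) : ℝ) : EReal) ≤ α) :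
    N ≤ ENNReal.ofReal (l ^ (-α)) := by
  have := (log_div_le_iff (N := N) (α := α) hl hl1 one_pos).1 (by simpa using h)
  simpa using this

theorem rpow_le_of_le_log_div (hl : 0 < l) (hl1 : l < 1)
    (h : α ≤ ENNReal.log N / ((Real.log (1 / l) : ℝ) : EReal)) :
    ENNReal.ofReal (l ^ (-α)) ≤ N := by
  have := (le_log_div_iff (N := N) (α := α) hl hl1 one_pos).1 (by simpa using h)
  simpa using this

theorem tendsto_rate (α M : ℝ) :
    Tendsto (fun l : ℝ => ((α + Real.log M / Real.log (1 / l) : ℝ) : EReal)) (𝓝[>] 0)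
      (𝓝 (α : EReal)) := by
  refine (continuous_coe_real_ereal.tendsto α).comp ?_
  have h : Tendsto (fun l : ℝ => Real.log (1 / l)) (𝓝[>] 0) atTop := by
    simp only [one_div]
    exact Real.tendsto_log_atTop.comp tendsto_inv_nhdsGT_zero
  simpa using (tendsto_const_nhds (x := α)).add (h.const_div_atTop (Real.log M))

theorem eventually_mem_Ioo : ∀ᶠ l : ℝ in 𝓝[>] 0, 0 < l ∧ l < 1 :=
  Ioo_mem_nhdsGT zero_lt_one

theorem limsup_log_div_le {f : ℝ → ℝ≥0∞} (hM : 0 < M)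
    (h : ∀ᶠ l in 𝓝[>] 0, f l ≤ ENNReal.ofReal (M * l ^ (-α))) :
    limsup (fun l : ℝ => ENNReal.log (f l) / ((Real.log (1 / l) : ℝ) : EReal)) (𝓝[>] 0) ≤ α := by
  rw [← (tendsto_rate α M).limsup_eq]
  refine limsup_le_limsup ?_
  filter_upwards [h, eventually_mem_Ioo] with l hl h01
  exact (log_div_le_iff h01.1 h01.2 hM).2 hl

theorem le_liminf_log_div {f : ℝ → ℝ≥0∞} (hM : 0 < M)
    (h : ∀ᶠ l in 𝓝[>] 0, ENNReal.ofReal (M * l ^ (-α)) ≤ f l) :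
    α ≤ liminf (fun l : ℝ => ENNReal.log (f l) / ((Real.log (1 / l) : ℝ) : EReal)) (𝓝[>] 0) := by
  rw [← (tendsto_rate α M).liminf_eq]
  refine liminf_le_liminf ?_
  filter_upwards [h, eventually_mem_Ioo] with l hl h01
  exact (le_log_div_iff h01.1 h01.2 hM).2 hl

theorem limsup_limsup_log_div_le {f : ℝ → ℝ → ℝ≥0∞} (hM : 0 < M)
    (h : ∀ᶠ l in 𝓝[>] 0, ∀ᶠ r in 𝓝[>] (0 : ℝ), f l r ≤ ENNReal.ofReal (M * l ^ (-α))) :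
    limsup (fun l : ℝ => limsup (fun r : ℝ =>
      ENNReal.log (f l r) / ((Real.log (1 / l) : ℝ) : EReal)) (𝓝[>] 0)) (𝓝[>] 0) ≤ α := by
  rw [← (tendsto_rate α M).limsup_eq]
  refine limsup_le_limsup ?_
  filter_upwards [h, eventually_mem_Ioo] with l hl h01
  refine limsup_le_of_le (h := ?_)
  filter_upwards [hl] with r hr
  exact (log_div_le_iff h01.1 h01.2 hM).2 hr

theorem le_liminf_liminf_log_div {f : ℝ → ℝ → ℝ≥0∞} (hM : 0 < M)
    (h : ∀ᶠ l in 𝓝[>] 0, ∀ᶠ r in 𝓝[>] (0 : ℝ), ENNReal.ofReal (M * l ^ (-α)) ≤ f l r) :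
    α ≤ liminf (fun l : ℝ => liminf (fun r : ℝ =>
      ENNReal.log (f l r) / ((Real.log (1 / l) : ℝ) : EReal)) (𝓝[>] 0)) (𝓝[>] 0) := by
  rw [← (tendsto_rate α M).liminf_eq]
  refine liminf_le_liminf ?_
  filter_upwards [h, eventually_mem_Ioo] with l hl h01
  refine le_liminf_of_le (h := ?_)
  filter_upwards [hl] with r hr
  exact (le_log_div_iff h01.1 h01.2 hM).2 hr

theorem rpow_neg_le_of_le_two_mul {s t : ℝ} (hs : 0 < s) (hst : s ≤ 2 * t) (hts : t ≤ 2 * s)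
    (α : ℝ) : s ^ (-α) ≤ 2 ^ |α| * t ^ (-α) := by
  have ht : 0 < t := by linarith
  rcases le_total 0 α with h | h
  · rw [abs_of_nonneg h]
    calc s ^ (-α) ≤ (t / 2) ^ (-α) :=
          Real.rpow_le_rpow_of_nonpos (by positivity) (by linarith) (by linarith)
      _ = 2 ^ α * t ^ (-α) := by
          rw [Real.div_rpow ht.le zero_le_two, Real.rpow_neg zero_le_two, div_inv_eq_mul, mul_comm]
  · rw [abs_of_nonpos h]
    calc s ^ (-α) ≤ (2 * t) ^ (-α) := Real.rpow_le_rpow hs.le hst (by linarith)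
      _ = 2 ^ (-α) * t ^ (-α) := Real.mul_rpow zero_le_two ht.le

theorem ofReal_two_rpow_pow (α : ℝ) (n : ℕ) :
    ENNReal.ofReal (2 ^ α) ^ n = ENNReal.ofReal (((1 / 2 : ℝ) ^ n) ^ (-α)) := by
  rw [← ENNReal.ofReal_pow (by positivity), ← Real.rpow_natCast, ← Real.rpow_natCast,
    ← Real.rpow_mul zero_le_two, ← Real.rpow_mul (by norm_num), one_div,
    Real.inv_rpow zero_le_two, ← Real.rpow_neg zero_le_two]
  congr 2
  ring

/-- A bound at the scales `2⁻ⁿ` for a decreasing function is a bound at all scales. -/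
theorem le_rpow_of_dyadic {f : ℝ → ℝ≥0∞} (hf : ∀ s t, 0 < s → s ≤ t → f t ≤ f s) (hM : 0 ≤ M)
    (h : ∀ n : ℕ, f ((1 / 2) ^ n) ≤ ENNReal.ofReal M * ENNReal.ofReal (2 ^ α) ^ n)
    (hl : 0 < l) (hl1 : l < 1) : f l ≤ ENNReal.ofReal (M * 2 ^ |α| * l ^ (-α)) := by
  obtain ⟨n, hn, hn'⟩ := exists_nat_pow_near_of_lt_one hl hl1.le
    (by norm_num : (0 : ℝ) < 1 / 2) (by norm_num)
  refine (hf _ _ (by positivity) hn.le).trans ((h (n + 1)).trans ?_)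
  rw [ofReal_two_rpow_pow, ← ENNReal.ofReal_mul hM, mul_assoc]
  refine ENNReal.ofReal_le_ofReal (mul_le_mul_of_nonneg_left ?_ hM)
  refine rpow_neg_le_of_le_two_mul (by positivity) (by linarith) ?_ α
  rw [pow_succ]
  linarith

theorem rpow_le_of_dyadic {f : ℝ → ℝ≥0∞} (hf : ∀ s t, 0 < s → s ≤ t → f t ≤ f s) (hM : 0 < M)
    (h : ∀ n : ℕ, ENNReal.ofReal (2 ^ α) ^ n ≤ ENNReal.ofReal M * f ((1 / 2) ^ n))
    (hl : 0 < l) (hl1 : l < 1) : ENNReal.ofReal ((M * 2 ^ |α|)⁻¹ * l ^ (-α)) ≤ f l := by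
  obtain ⟨n, hn, hn'⟩ := exists_nat_pow_near_of_lt_one hl hl1.le
    (by norm_num : (0 : ℝ) < 1 / 2) (by norm_num)
  refine le_trans ?_ (hf _ _ hl hn')
  refine (ENNReal.mul_le_mul_iff_right (by simpa using hM : ENNReal.ofReal M ≠ 0)
    ENNReal.ofReal_ne_top).1 (le_trans ?_ (h n))
  rw [ofReal_two_rpow_pow, ← ENNReal.ofReal_mul hM.le]
  refine ENNReal.ofReal_le_ofReal ?_
  have h2 : (0 : ℝ) < 2 ^ |α| := by positivity
  rw [show M * ((M * 2 ^ |α|)⁻¹ * l ^ (-α)) = (2 ^ |α|)⁻¹ * l ^ (-α) by field_simp,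
    inv_mul_le_iff₀ h2]
  refine rpow_neg_le_of_le_two_mul hl (by nlinarith [hl]) ?_ α
  rw [pow_succ] at hn
  linarith

end Rates

section Scales

variable {X : Type u} [MetricSpace X] {x : X}

theorem coverNum_toENNReal_anti {Y : Type u} [MetricSpace Y] (E : Set Y) {s t : ℝ} (h : s ≤ t) :
    ((coverNum t E : ℕ∞) : ℝ≥0∞) ≤ (coverNum s E : ℕ∞) :=
  ENat.toENNReal_le.2 (coverNum_anti h E)

/-- If `α` is less than the upper tangential dimension, then there are arbitrarily small scales from
which the covering numbers grow at rate at least `α` at every later scale in a range of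
prescribed length. Otherwise the greedy concatenation of short descents would bound the growth at
all small scales by the rate `α`. -/
theorem exists_scale_of_lt_upperTangentialDim (hunif : UniformCovering x) (hfin : FiniteCovering x)
    {α : ℝ} (hα : (α : EReal) < upperTangentialDim x) :
    ∃ M : ℝ, 0 < M ∧ ∀ (H : ℕ) (r₀ : ℝ), 0 < r₀ → ∃ r, 0 < r ∧ r < r₀ ∧ ∀ s ≤ H,
      ENNReal.ofReal (2 ^ α) ^ s ≤ ENNReal.ofReal M * (dyadicCover x r s : ℕ∞) := by
  obtain ⟨c, hc, a, ha, hc'⟩ := hunif.exists_nat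
  refine ⟨c, by exact_mod_cast hc, fun H r₀ hr₀ => ?_⟩
  by_contra! hcon
  refine hα.not_ge ?_
  obtain ⟨K, r₁, hr₁, hK⟩ := hfin.dyadicCover_le H
  set A := ENNReal.ofReal (2 ^ α) with hA
  have hA0 : A ≠ 0 := by
    simp only [hA, ne_eq, ENNReal.ofReal_eq_zero, not_le]
    positivity
  have hA' : A ≠ ⊤ := ENNReal.ofReal_ne_top
  set r₂ := min (min r₀ r₁) (a / 2) with hr₂
  have hr₂0 : 0 < r₂ := by positivity
  have key := le_mul_pow_of_forall_exists (q := fun r s => ((dyadicCover x r s : ℕ∞) : ℝ≥0∞))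
    (c := c) (K := K) (r₀ := r₂) (H := H) hA0 hA' ?_ ?_ ?_
  · set B : ℝ≥0∞ := K * (1 + A⁻¹) ^ H with hB
    have hBtop : B ≠ ⊤ := ENNReal.mul_ne_top (ENNReal.natCast_ne_top K)
      (ENNReal.pow_ne_top (ENNReal.add_ne_top.2 ⟨ENNReal.one_ne_top, ENNReal.inv_ne_top.2 hA0⟩))
    refine limsup_limsup_log_div_le (M := (B.toReal + 1) * 2 ^ |α|) (by positivity) ?_
    filter_upwards [eventually_mem_Ioo] with l hl
    filter_upwards [Ioo_mem_nhdsGT hr₂0] with r hr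
    refine le_rpow_of_dyadic
      (f := fun l => ((coverNum (l * r) (Metric.closedBall x r) : ℕ∞) : ℝ≥0∞))
      (fun s t _ hst => coverNum_toENNReal_anti _ (mul_le_mul_of_nonneg_right hst hr.1.le))
      (by positivity) (fun n => ?_) hl.1 hl.2
    refine (key n r hr.1 hr.2).trans ?_
    gcongr
    rw [← ENNReal.ofReal_toReal hBtop]
    exact ENNReal.ofReal_le_ofReal (by simp)
  · intro r hr hlt s u
    have := dyadicCover_add_le hc hc' hr (by linarith [hlt.trans_le (min_le_right _ _)]) s u
    exact_mod_cast ENat.toENNReal_le.2 this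
  · intro r hr hlt s hs
    have := (dyadicCover_mono hr hs).trans
      (hK r hr (hlt.trans_le ((min_le_left _ _).trans (min_le_right _ _))))
    exact_mod_cast ENat.toENNReal_le.2 this
  · intro r hr hlt
    obtain ⟨s, hsH, hs⟩ := hcon r hr (hlt.trans_le ((min_le_left _ _).trans (min_le_left _ _)))
    rw [ENNReal.ofReal_natCast] at hs
    refine ⟨s, Nat.one_le_iff_ne_zero.2 ?_, hsH, hs.le⟩
    rintro rfl
    rw [pow_zero] at hs
    refine hs.not_ge (one_le_mul (by exact_mod_cast hc) ?_)
    exact_mod_cast ENat.toENNReal_le.2 (one_le_dyadicCover hr 0)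

/-- The counterpart of `exists_scale_of_lt_upperTangentialDim` for slow growth. -/
theorem exists_scale_of_lowerTangentialDim_lt (hunif : UniformCovering x) (hfin : FiniteCovering x)
    {α : ℝ} (hα : lowerTangentialDim x < α) :
    ∃ M : ℝ, 0 < M ∧ ∀ (H : ℕ) (r₀ : ℝ), 0 < r₀ → ∃ r, 0 < r ∧ r < r₀ ∧ ∀ s ≤ H,
      ((dyadicCover x r s : ℕ∞) : ℝ≥0∞) ≤ ENNReal.ofReal M * ENNReal.ofReal (2 ^ α) ^ s := by
  obtain ⟨c, hc, r₁, hr₁, hc'⟩ := exists_dyadicCover_mul_le hunif hfin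
  obtain ⟨K, r₂, hr₂, hK⟩ := hfin.dyadicCover_le 0
  set A := ENNReal.ofReal (2 ^ α) with hA
  have hA' : A ≠ ⊤ := ENNReal.ofReal_ne_top
  -- adding `K`, which bounds `dyadicCover x r 0`, makes the estimate hold also for `s = 0`
  refine ⟨c + K, by positivity, fun H r₀ hr₀ => ?_⟩
  by_contra! hcon
  refine hα.not_ge ?_
  set r₃ := min (min r₀ r₁) r₂ with hr₃
  have hr₃0 : 0 < r₃ := by positivity
  have key := pow_le_mul_of_forall_exists (q := fun r s => ((dyadicCover x r s : ℕ∞) : ℝ≥0∞))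
    (c := c) (A := A) (r₀ := r₃) (H := H) (by exact_mod_cast (by omega : c ≠ 0))
    (ENNReal.natCast_ne_top c) ?_ ?_ ?_
  · set B : ℝ≥0∞ := (1 + A) ^ H with hB
    have hBtop : B ≠ ⊤ := ENNReal.pow_ne_top (ENNReal.add_ne_top.2 ⟨ENNReal.one_ne_top, hA'⟩)
    have hB1 : 0 < B.toReal := ENNReal.toReal_pos (pow_ne_zero _ (by simp)) hBtop
    refine le_liminf_liminf_log_div (M := (B.toReal * 2 ^ |α|)⁻¹) (by positivity) ?_
    filter_upwards [eventually_mem_Ioo] with l hl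
    filter_upwards [Ioo_mem_nhdsGT hr₃0] with r hr
    refine rpow_le_of_dyadic
      (f := fun l => ((coverNum (l * r) (Metric.closedBall x r) : ℕ∞) : ℝ≥0∞))
      (fun s t _ hst => coverNum_toENNReal_anti _ (mul_le_mul_of_nonneg_right hst hr.1.le))
      hB1 (fun n => ?_) hl.1 hl.2
    rw [ENNReal.ofReal_toReal hBtop]
    exact key n r hr.1 hr.2
  · intro r hr hlt s u
    have := hc' r hr (hlt.trans_le ((min_le_left _ _).trans (min_le_right _ _))) s u
    exact_mod_cast ENat.toENNReal_le.2 this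
  · intro r hr hlt s
    exact_mod_cast ENat.toENNReal_le.2 (one_le_dyadicCover hr s)
  · intro r hr hlt
    obtain ⟨s, hsH, hs⟩ := hcon r hr (hlt.trans_le ((min_le_left _ _).trans (min_le_left _ _)))
    have hcast : ENNReal.ofReal ((c : ℝ) + K) = (c : ℝ≥0∞) + K := by
      exact_mod_cast ENNReal.ofReal_natCast (c + K)
    rw [hcast] at hs
    refine ⟨s, Nat.one_le_iff_ne_zero.2 ?_, hsH, le_trans ?_ hs.le⟩
    · rintro rfl
      rw [pow_zero, mul_one] at hs
      refine hs.not_ge (le_trans ?_ le_add_self)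
      exact_mod_cast ENat.toENNReal_le.2 (hK r hr (hlt.trans_le (min_le_right _ _)))
    · gcongr
      exact le_self_add

end Scales

/-! ### Gromov-Hausdorff closeness to a rescaled space -/

section Closeness

variable {X : Type u} [MetricSpace X] {x : X}

/-- Closeness of `tX` to `T` yields a relation between `T` and `X` that is total on the balls of
radius `R` and almost preserves distances. -/
theorem exists_rel_of_mem_pGHNhd {T : PointedMetricSpace.{u}} {t R ε : ℝ} {ht : 0 < t}
    (h : rescale x t ht ∈ pGHNhd T R ε) :
    ∃ rel : T.carrier → X → Prop, (∀ p ∈ Metric.closedBall T.pt R, ∃ q, rel p q) ∧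
      (∀ q, t * dist q x ≤ R → ∃ p, rel p q) ∧ rel T.pt x ∧
      ∀ p p' q q', rel p q → rel p' q' → |dist p p' - t * dist q q'| < 2 * ε := by
  simp only [pGHNhd, pGHDist, Set.mem_ofPred_eq, iInf_lt_iff] at h
  obtain ⟨δ, ⟨hδ, Z, mZ, φ, ψ, hφ, hψ, hpt, hφR, hψR⟩, hlt⟩ := h
  have hδε : δ < ε := (ENNReal.ofReal_lt_ofReal_iff'.1 hlt).1
  have hψd : ∀ q q' : X, dist (ψ q) (ψ q') = t * dist q q' := fun q q' => hψ.dist_eq q q'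
  refine ⟨fun p q => dist (φ p) (ψ q) < δ, ?_, ?_, hpt, ?_⟩
  · intro p hp
    obtain ⟨_, ⟨q, rfl⟩, hq⟩ := Metric.mem_thickening_iff.1 (hφR ⟨p, hp, rfl⟩)
    exact ⟨q, hq⟩
  · intro q hq
    obtain ⟨_, ⟨p, rfl⟩, hp⟩ := Metric.mem_thickening_iff.1 (hψR ⟨q, hq, rfl⟩)
    exact ⟨p, (dist_comm _ _).trans_lt hp⟩
  · intro p p' q q' h1 h2
    rw [← hφ.dist_eq p p', ← hψd q q']
    have e1 := dist_triangle4 (φ p) (ψ q) (ψ q') (φ p')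
    have e2 := dist_triangle4 (ψ q) (φ p) (φ p') (ψ q')
    rw [dist_comm (ψ q') (φ p')] at e1
    rw [dist_comm (ψ q) (φ p)] at e2
    rw [abs_lt]
    constructor <;> linarith

/-- Covering numbers of balls of `T` are bounded by those of balls of `X` at the scale at which `X`
is close to `T`. -/
theorem coverNum_le_of_mem_pGHNhd {T : PointedMetricSpace.{u}} {t R ε r s S : ℝ} {ht : 0 < t}
    (h : rescale x t ht ∈ pGHNhd T R ε) (hs : 2 * ε + t * (2 * r) ≤ s) (hS : R + 2 * ε ≤ t * S) :
    coverNum s (Metric.closedBall T.pt R) ≤ coverNum r (Metric.closedBall x S) := by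
  obtain ⟨rel, h1, -, h3, h4⟩ := exists_rel_of_mem_pGHNhd h
  refine coverNum_le_of_rel rel (fun p hp => ?_) fun p p' q q' hpq hpq' hlt => ?_
  · obtain ⟨q, hq⟩ := h1 p hp
    refine ⟨q, ?_, hq⟩
    have := (abs_lt.1 (h4 _ _ _ _ hq h3)).1
    rw [Metric.mem_closedBall] at hp ⊢
    exact le_of_mul_le_mul_left (by linarith) ht
  · have := (abs_lt.1 (h4 _ _ _ _ hpq hpq')).2
    have h5 := mul_lt_mul_of_pos_left hlt ht
    linarith

theorem coverNum_le_of_mem_pGHNhd' {T : PointedMetricSpace.{u}} {t R ε r s S : ℝ} {ht : 0 < t}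
    (h : rescale x t ht ∈ pGHNhd T R ε) (hs : 2 * ε + 2 * r ≤ t * s) (hS : t * S ≤ R) :
    coverNum s (Metric.closedBall x S) ≤ coverNum r (Metric.closedBall T.pt (R + 2 * ε)) := by
  obtain ⟨rel, -, h2, h3, h4⟩ := exists_rel_of_mem_pGHNhd h
  refine coverNum_le_of_rel (fun q p => rel p q) (fun q hq => ?_)
    fun q q' p p' hpq hpq' hlt => ?_
  · rw [Metric.mem_closedBall] at hq
    have hq' : t * dist q x ≤ R := (mul_le_mul_of_nonneg_left hq ht.le).trans hS
    obtain ⟨p, hp⟩ := h2 q hq'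
    refine ⟨p, ?_, hp⟩
    have := (abs_lt.1 (h4 _ _ _ _ hp h3)).2
    rw [Metric.mem_closedBall]
    linarith
  · have := (abs_lt.1 (h4 _ _ _ _ hpq hpq')).1
    exact lt_of_mul_lt_mul_left (by linarith) ht.le

/-- Almost isometric finite nets in `T` and in `tX` glue the two spaces into one metric space in
which they are close. -/
theorem mem_pGHNhd_of_nets {T : PointedMetricSpace.{u}} {t R ε δ : ℝ} {ht : 0 < t} {ι : Type*}
    (hδ : 0 < δ) (hδε : 3 * δ ≤ ε) (f : ι → T.carrier) (g : ι → X) (i₀ : ι) (hf : f i₀ = T.pt)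
    (hg : g i₀ = x) (hfR : ∀ p ∈ Metric.closedBall T.pt R, ∃ i, dist p (f i) ≤ δ)
    (hgR : ∀ q, t * dist q x ≤ R → ∃ i, t * dist q (g i) ≤ δ)
    (hfg : ∀ i j, |dist (f i) (f j) - t * dist (g i) (g j)| ≤ 2 * δ) :
    rescale x t ht ∈ pGHNhd T R ε := by
  have : Nonempty ι := ⟨i₀⟩
  let g' : ι → (rescale x t ht).carrier := g
  let mZ : MetricSpace (T.carrier ⊕ (rescale x t ht).carrier) :=
    Metric.glueMetricApprox f g' δ hδ hfg
  have hφ : Isometry (Sum.inl : T.carrier → T.carrier ⊕ (rescale x t ht).carrier) :=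
    Isometry.of_dist_eq fun _ _ => rfl
  have hψ : Isometry (Sum.inr : (rescale x t ht).carrier → T.carrier ⊕ (rescale x t ht).carrier) :=
    Isometry.of_dist_eq fun _ _ => rfl
  have hglue : ∀ i, dist (Sum.inl (f i) : T.carrier ⊕ (rescale x t ht).carrier) (Sum.inr (g' i))
      = δ := fun i => Metric.glueDist_glued_points f g' δ i
  have hlt : ENNReal.ofReal (5 / 2 * δ) < ENNReal.ofReal ε :=
    (ENNReal.ofReal_lt_ofReal_iff (by linarith)).2 (by linarith)
  suffices hle : pGHDist R T (rescale x t ht) ≤ ENNReal.ofReal (5 / 2 * δ) from hle.trans_lt hlt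
  refine iInf₂_le (5 / 2 * δ) ⟨by positivity, _, mZ, Sum.inl, Sum.inr, hφ, hψ, ?_, ?_, ?_⟩
  · have := hglue i₀
    rw [hf, show g' i₀ = (rescale x t ht).pt from hg] at this
    rw [this]
    linarith
  · rintro _ ⟨p, hp, rfl⟩
    obtain ⟨i, hi⟩ := hfR p hp
    refine Metric.mem_thickening_iff.2 ⟨_, ⟨g' i, rfl⟩, ?_⟩
    have h1 := dist_triangle (Sum.inl p : T.carrier ⊕ (rescale x t ht).carrier)
      (Sum.inl (f i)) (Sum.inr (g' i))
    rw [hglue, hφ.dist_eq] at h1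
    linarith
  · rintro _ ⟨q, hq, rfl⟩
    obtain ⟨i, hi⟩ := hgR q hq
    refine Metric.mem_thickening_iff.2 ⟨_, ⟨f i, rfl⟩, ?_⟩
    have h1 := dist_triangle (Sum.inr q : T.carrier ⊕ (rescale x t ht).carrier)
      (Sum.inr (g' i)) (Sum.inl (f i))
    have h2 : dist q (g' i) = t * dist (α := X) q (g i) := rfl
    rw [dist_comm (Sum.inr (g' i)) (Sum.inl (f i)), hglue, hψ.dist_eq, h2] at h1
    linarith

end Closeness

/-! ### Ultralimits of rescaled spaces -/

section Ultralimit

variable {X : Type u} [MetricSpace X]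

/-- Sequences in `X` that stay at bounded distance from `x` in the metrics `d / r k`. -/
def BoundedSeq (x : X) (r : ℕ → ℝ) (_ : ∀ k, 0 < r k) : Type u :=
  {f : ℕ → X // ∃ B, ∀ k, dist (f k) x ≤ B * r k}

namespace BoundedSeq

variable {x : X} {r : ℕ → ℝ} {hr : ∀ k, 0 < r k}

/-- The limit of the distances in the metrics `d / r k`, along a nonprincipal ultrafilter. -/
noncomputable instance : Dist (BoundedSeq x r hr) where
  dist f g := limUnder (hyperfilter ℕ : Filter ℕ) fun k => dist (f.1 k) (g.1 k) / r k

theorem tendsto_dist (f g : BoundedSeq x r hr) :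
    Tendsto (fun k => dist (f.1 k) (g.1 k) / r k) (hyperfilter ℕ) (𝓝 (dist f g)) := by
  refine tendsto_nhds_limUnder ?_
  obtain ⟨B, hB⟩ := f.2
  obtain ⟨B', hB'⟩ := g.2
  have hmem : ∀ k, dist (f.1 k) (g.1 k) / r k ∈ Set.Icc 0 (B + B') := by
    intro k
    refine ⟨div_nonneg dist_nonneg (hr k).le, ?_⟩
    rw [div_le_iff₀ (hr k)]
    linarith [dist_triangle_right (f.1 k) (g.1 k) x, hB k, hB' k]
  obtain ⟨y, -, hy⟩ := (isCompact_Icc (a := (0 : ℝ)) (b := B + B')).ultrafilter_le_nhds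
    ((hyperfilter ℕ).map fun k => dist (f.1 k) (g.1 k) / r k)
    (le_principal_iff.2 (Filter.mem_map.2 (Filter.univ_mem' hmem)))
  exact ⟨y, hy⟩

noncomputable instance : PseudoMetricSpace (BoundedSeq x r hr) where
  dist_self f := tendsto_nhds_unique (tendsto_dist f f) (by simp)
  dist_comm f g := tendsto_nhds_unique (tendsto_dist f g) (by
    simpa only [dist_comm] using tendsto_dist g f)
  dist_triangle f g h := by
    refine le_of_tendsto_of_tendsto' (tendsto_dist f h)
      ((tendsto_dist f g).add (tendsto_dist g h)) fun k => ?_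
    rw [← add_div]
    exact div_le_div_of_nonneg_right (dist_triangle _ _ _) (hr k).le

/-- The constant sequence at the base point. -/
def base (x : X) (r : ℕ → ℝ) (hr : ∀ k, 0 < r k) : BoundedSeq x r hr :=
  ⟨fun _ => x, 0, fun _ => by simp⟩

/-- Finitely many bounded sequences form, at almost every index, a net of the ball of radius
`R`. -/
theorem exists_net (hfin : FiniteCovering x) (hlim : Tendsto r atTop (𝓝 0)) {R δ : ℝ}
    (hR : 0 < R) (hδ : 0 < δ) : ∃ (n : ℕ) (F : Fin n → BoundedSeq x r hr),
      ∀ᶠ k in (hyperfilter ℕ : Filter ℕ), ∀ y, dist y x ≤ R * r k →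
        ∃ i, dist y ((F i).1 k) < δ * r k := by
  obtain ⟨K, r₀, hr₀, hK⟩ := hfin.eventually_le (div_pos hδ hR)
  have hsmall : ∀ᶠ k in atTop, R * r k < r₀ := by
    have : Tendsto (fun k => R * r k) atTop (𝓝 0) := by simpa using hlim.const_mul R
    exact this.eventually_lt_const hr₀
  have hex : ∀ k, ∃ F : Fin K → X, (∀ i, dist (F i) x ≤ (R + δ) * r k) ∧ (R * r k < r₀ →
      ∀ y, dist y x ≤ R * r k → ∃ i, dist y (F i) < δ * r k) := by
    intro k
    have hrk := hr k
    by_cases hk : R * r k < r₀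
    swap
    · exact ⟨fun _ => x, fun _ => by rw [dist_self]; positivity, fun h => absurd h hk⟩
    have h1 := hK (R * r k) (by positivity) hk
    rw [show δ / R * (R * r k) = δ * r k by field_simp] at h1
    obtain ⟨C, hC, hC', hCfin⟩ := exists_encard_eq_coverNum
      (ne_top_of_le_ne_top (ENat.natCast_ne_top K) h1)
    rw [← hC', hCfin.encard_eq_coe_toFinset_card] at h1
    have hcard : hCfin.toFinset.card ≤ K := by exact_mod_cast h1
    classical
    -- an enumeration of `C`, with the centers that are too far from `x` replaced by `x`
    obtain ⟨e, he⟩ : ∃ e : Fin K → X, C ⊆ Set.range e := by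
      let E := hCfin.toFinset.equivFin
      refine ⟨fun i => if h : i.1 < hCfin.toFinset.card then (E.symm ⟨i.1, h⟩ : X) else x, ?_⟩
      intro y hy
      let j := E ⟨y, hCfin.mem_toFinset.2 hy⟩
      refine ⟨⟨j.1, j.2.trans_le hcard⟩, ?_⟩
      simp [j]
    refine ⟨fun i => if dist (e i) x ≤ (R + δ) * r k then e i else x, fun i => ?_, fun _ y hy => ?_⟩
    · dsimp only
      split_ifs with h
      · exact h
      · rw [dist_self]; positivity
    · obtain ⟨c, hc, hyc⟩ := Set.mem_iUnion₂.1 (hC (Metric.mem_closedBall.2 hy))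
      obtain ⟨i, rfl⟩ := he hc
      rw [Metric.mem_ball] at hyc
      refine ⟨i, ?_⟩
      dsimp only
      rw [if_pos]
      · exact hyc
      · linarith [dist_triangle_left (e i) x y]
  choose F hF hF' using hex
  refine ⟨K, fun i => ⟨fun k => F k i, R + δ, fun k => hF k i⟩, ?_⟩
  filter_upwards [Nat.hyperfilter_le_atTop hsmall] with k hk
  exact hF' k hk

/-- A net at almost every index is a net of the limit. -/
theorem exists_dist_le_of_net {R δ : ℝ} {n : ℕ} {F : Fin n → BoundedSeq x r hr}
    (hF : ∀ᶠ k in (hyperfilter ℕ : Filter ℕ), ∀ y, dist y x ≤ R * r k →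
        ∃ i, dist y ((F i).1 k) < δ * r k)
    (f : BoundedSeq x r hr) (hf : dist f (base x r hr) < R) : ∃ i, dist f (F i) ≤ δ := by
  by_contra! hcon
  have h1 : ∀ᶠ k in (hyperfilter ℕ : Filter ℕ), ∀ i, δ < dist (f.1 k) ((F i).1 k) / r k :=
    eventually_all.2 fun i => (tendsto_dist f (F i)).eventually_const_lt (hcon i)
  obtain ⟨k, hk, hk1, hk2⟩ := (hF.and (h1.and
    ((tendsto_dist f (base x r hr)).eventually_lt_const hf))).exists
  obtain ⟨i, hi⟩ := hk (f.1 k) ((div_lt_iff₀ (hr k)).1 hk2).le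
  exact lt_asymm hi ((lt_div_iff₀ (hr k)).1 (hk1 i))

theorem totallyBounded_ball (hfin : FiniteCovering x) (hlim : Tendsto r atTop (𝓝 0)) {R : ℝ}
    (hR : 0 < R) : TotallyBounded (Metric.ball (base x r hr) R) := by
  refine Metric.totallyBounded_iff.2 fun ε hε => ?_
  obtain ⟨n, F, hF⟩ := exists_net (hr := hr) hfin hlim hR (half_pos hε)
  refine ⟨Set.range F, Set.finite_range F, fun f hf => ?_⟩
  obtain ⟨i, hi⟩ := exists_dist_le_of_net hF f hf
  exact Set.mem_iUnion₂.2 ⟨F i, ⟨i, rfl⟩, Metric.mem_ball.2 (hi.trans_lt (half_lt_self hε))⟩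

end BoundedSeq

open UniformSpace BoundedSeq in
/-- Precompactness of the rescalings of `X`: along any sequence of scales tending to zero they
accumulate at some proper pointed space, the completion of the ultralimit. -/
theorem exists_limit {x : X} (hfin : FiniteCovering x) {r : ℕ → ℝ} (hr : ∀ k, 0 < r k)
    (hlim : Tendsto r atTop (𝓝 0)) :
    ∃ T : PointedMetricSpace.{u}, ProperSpace T.carrier ∧ ∀ R : ℝ, 0 < R → ∀ ε : ℝ, 0 < ε →
      ∃ᶠ k in atTop, rescale x (r k)⁻¹ (inv_pos.2 (hr k)) ∈ pGHNhd T R ε := by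
  let T : PointedMetricSpace.{u} := ⟨Completion (BoundedSeq x r hr), (base x r hr : Completion _)⟩
  have happrox : ∀ (p : T.carrier) (δ : ℝ), 0 < δ → ∃ f : BoundedSeq x r hr,
      dist p (f : Completion (BoundedSeq x r hr)) < δ := fun p δ hδ =>
    Completion.denseRange_coe.exists_dist_lt p hδ
  refine ⟨T, ?_, fun R hR ε hε => ?_⟩
  · refine ProperSpace.of_seq_closedBall (β := ℕ) (l := atTop) (x := T.pt)
      (r := fun n => (n : ℝ)) tendsto_natCast_atTop_atTop (Eventually.of_forall fun n => ?_)
    refine isCompact_iff_totallyBounded_isComplete.2 ⟨?_, Metric.isClosed_closedBall.isComplete⟩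
    have h1 := (totallyBounded_ball (hr := hr) hfin hlim
      (by positivity : (0 : ℝ) < n + 1)).image (Completion.uniformContinuous_coe _)
    refine h1.closure.subset fun p hp => Metric.mem_closure_iff.2 fun δ hδ => ?_
    obtain ⟨f, hf⟩ := happrox p (min δ 1) (by positivity)
    refine ⟨f, ⟨f, ?_, rfl⟩, hf.trans_le (min_le_left _ _)⟩
    rw [Metric.mem_ball, ← Completion.dist_eq]
    have := hf.trans_le (min_le_right _ _)
    rw [Metric.mem_closedBall] at hp
    linarith [dist_triangle_left (f : Completion (BoundedSeq x r hr)) T.pt p]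
  · refine Frequently.filter_mono ?_ Nat.hyperfilter_le_atTop
    refine Eventually.frequently ?_
    set δ := ε / 3 with hδ
    have hδ0 : 0 < δ := by positivity
    obtain ⟨n, F, hF⟩ := exists_net (hr := hr) hfin hlim (by positivity : 0 < R + δ) (half_pos hδ0)
    -- the net together with the base point, which has to be glued to `x`
    let G : Option (Fin n) → BoundedSeq x r hr := fun i => i.elim (base x r hr) F
    have hclose : ∀ᶠ k in (hyperfilter ℕ : Filter ℕ), ∀ i j,
        |dist (G i) (G j) - (r k)⁻¹ * dist ((G i).1 k) ((G j).1 k)| ≤ 2 * δ := by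
      refine eventually_all.2 fun i => eventually_all.2 fun j => ?_
      filter_upwards [Metric.tendsto_nhds.1 (tendsto_dist (G i) (G j)) (2 * δ) (by positivity)]
        with k hk
      rw [dist_comm, Real.dist_eq, div_eq_inv_mul] at hk
      exact hk.le
    filter_upwards [hF, hclose] with k hk hk'
    have hrk := hr k
    refine mem_pGHNhd_of_nets (T := T) (δ := δ) hδ0 (by linarith)
      (fun i => (G i : Completion (BoundedSeq x r hr))) (fun i => (G i).1 k) none rfl rfl ?_ ?_ ?_
    · intro p hp
      obtain ⟨f, hf⟩ := happrox p (δ / 2) (half_pos hδ0)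
      obtain ⟨i, hi⟩ := exists_dist_le_of_net hF f (by
        rw [← Completion.dist_eq]
        rw [Metric.mem_closedBall] at hp
        have := dist_triangle_left (f : Completion (BoundedSeq x r hr)) T.pt p
        have e : T.pt = (base x r hr : Completion (BoundedSeq x r hr)) := rfl
        rw [e] at this hp
        linarith)
      refine ⟨some i, ?_⟩
      rw [← Completion.dist_eq] at hi
      have := dist_triangle p (f : Completion (BoundedSeq x r hr)) (F i)
      exact this.trans (by linarith)
    · intro q hq
      obtain ⟨i, hi⟩ := hk q (by
        rw [inv_mul_le_iff₀ hrk] at hq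
        nlinarith)
      refine ⟨some i, ?_⟩
      rw [inv_mul_le_iff₀ hrk]
      refine hi.le.trans ?_
      nlinarith
    · intro i j
      have h := hk' i j
      rwa [← Completion.dist_eq] at h

end Ultralimit

/-! ### Box dimensions of tangent sets -/

section Tangent

variable {X : Type u} [MetricSpace X] {x : X}

theorem lowerBoxDim_le_upperBoxDim (p : X) : lowerBoxDim p ≤ upperBoxDim p :=
  iSup_mono fun _ => liminf_le_limsup

theorem upperBallDim_le_of_le (p : X) {R S : ℝ} (h : R ≤ S) : upperBallDim p R ≤ upperBallDim p S :=
  limsup_le_limsup (eventually_quotient_mono p h)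

/-- A condition on `r` that holds for all small `r > 0` holds for `r = S / t` at some `t` for which
`tX` is close to a given tangent set. -/
theorem exists_close {T : PointedMetricSpace.{u}} (hT : T ∈ tangentCone x) {R ε S : ℝ} (hR : 0 < R)
    (hε : 0 < ε) (hε1 : ε < 1) (hS : 0 < S) {P : ℝ → Prop} (hP : ∀ᶠ r in 𝓝[>] (0 : ℝ), P r) :
    ∃ (t : ℝ) (ht : 0 < t), rescale x t ht ∈ pGHNhd T R ε ∧ P (S / t) := by
  have hlim : Tendsto (fun t : ℝ => S / t) atTop (𝓝[>] 0) := by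
    refine tendsto_nhdsWithin_iff.2 ⟨tendsto_const_nhds.div_atTop tendsto_id, ?_⟩
    filter_upwards [eventually_gt_atTop 0] with t ht
    exact div_pos hS ht
  obtain ⟨t, ⟨ht, h⟩, hPt⟩ := ((hT.2 R hR ε hε hε1).and_eventually (hlim.eventually hP)).exists
  exact ⟨t, ht, h, hPt⟩

/-- Box dimensions of tangent sets do not exceed the upper tangential dimension: covering numbers
of `X` at small scales pass to any tangent set. -/
theorem upperBoxDim_le_upperTangentialDim {T : PointedMetricSpace.{u}} (hT : T ∈ tangentCone x) :
    upperBoxDim T.pt ≤ upperTangentialDim x := by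
  refine EReal.le_of_forall_lt_iff_le.1 fun b hb => iSup_le fun R₀ => ?_
  set R := max R₀ 1 with hR
  have hR0 : 0 < R := lt_max_of_lt_right one_pos
  refine (upperBallDim_le_of_le T.pt (le_max_left R₀ 1)).trans ?_
  refine limsup_log_div_le (M := (8 * R) ^ b) (by positivity) ?_
  have hscale : Tendsto (fun s : ℝ => s / (8 * R)) (𝓝[>] 0) (𝓝[>] 0) := by
    refine tendsto_nhdsWithin_iff.2 ⟨?_, ?_⟩
    · have : Tendsto (fun s : ℝ => s / (8 * R)) (𝓝 0) (𝓝 (0 / (8 * R))) := tendsto_id.div_const _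
      rw [zero_div] at this
      exact this.mono_left nhdsWithin_le_nhds
    · filter_upwards [self_mem_nhdsWithin] with s hs
      exact div_pos (show 0 < s from hs) (by positivity)
  filter_upwards [hscale.eventually (eventually_lt_of_limsup_lt hb), eventually_mem_Ioo]
    with s hs hs01
  have hs0 := hs01.1
  have hs1 := hs01.2
  have hsR : s / (8 * R) < 1 := by
    rw [div_lt_one (by positivity)]
    linarith [le_max_right R₀ 1]
  have hsR0 : 0 < s / (8 * R) := by positivity
  obtain ⟨t, ht, hclose, hlt⟩ := exists_close hT (S := 2 * R) hR0 (by positivity : 0 < s / 4)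
    (by linarith) (by positivity) (eventually_lt_of_limsup_lt hs)
  -- the ball of radius `R` of `T` is close to part of the ball of radius `2 * R / t` of `X`, and
  -- balls of radius `s / 4` in `tX` become balls of radius `s` in `T`; this gives the ratio
  -- `s / (8 * R)`
  have hX := le_rpow_of_log_div_le hsR0 hsR hlt.le
  have hcov : coverNum s (Metric.ball T.pt R) ≤
      coverNum (s / (8 * R) * (2 * R / t)) (Metric.closedBall x (2 * R / t)) := by
    refine (coverNum_mono s Metric.ball_subset_closedBall).trans
      (coverNum_le_of_mem_pGHNhd hclose ?_ ?_)
    · rw [show t * (2 * (s / (8 * R) * (2 * R / t))) = s / 2 by field_simp; ring]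
      linarith
    · rw [mul_div_cancel₀ _ ht.ne']
      linarith [le_max_right R₀ 1]
  refine (ENat.toENNReal_le.2 hcov).trans (hX.trans (ENNReal.ofReal_le_ofReal ?_))
  rw [Real.div_rpow hs0.le (by positivity), Real.rpow_neg (by positivity : (0 : ℝ) ≤ 8 * R),
    div_inv_eq_mul, mul_comm]

/-- Box dimensions of tangent sets are not less than the lower tangential dimension. -/
theorem lowerTangentialDim_le_lowerBoxDim {T : PointedMetricSpace.{u}} (hT : T ∈ tangentCone x) :
    lowerTangentialDim x ≤ lowerBoxDim T.pt := by
  refine EReal.ge_of_forall_gt_iff_ge.1 fun b hb => ?_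
  refine le_trans ?_ (le_iSup (lowerBallDim T.pt) 2)
  refine le_liminf_log_div (M := 4 ^ (-b)) (by positivity) ?_
  have hscale : Tendsto (fun s : ℝ => 4 * s) (𝓝[>] 0) (𝓝[>] 0) := by
    refine tendsto_nhdsWithin_iff.2 ⟨?_, ?_⟩
    · have : Tendsto (fun s : ℝ => 4 * s) (𝓝 0) (𝓝 (4 * 0)) := tendsto_id.const_mul _
      rw [mul_zero] at this
      exact this.mono_left nhdsWithin_le_nhds
    · filter_upwards [self_mem_nhdsWithin] with s hs
      exact mul_pos four_pos (show 0 < s from hs)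
  filter_upwards [hscale.eventually (eventually_lt_of_lt_liminf hb),
    Ioo_mem_nhdsGT (by norm_num : (0 : ℝ) < 1 / 4)] with s hs hs01
  obtain ⟨hs0, hs1⟩ := hs01
  obtain ⟨t, ht, hclose, hlt⟩ := exists_close hT (S := 1) one_pos hs0 (by linarith) one_pos
    (eventually_lt_of_lt_liminf hs)
  have hX := rpow_le_of_le_log_div (by positivity) (by linarith) hlt.le
  have hcov : coverNum (4 * s * (1 / t)) (Metric.closedBall x (1 / t)) ≤
      coverNum s (Metric.ball T.pt 2) := by
    refine (coverNum_le_of_mem_pGHNhd' hclose (r := s) ?_ ?_).trans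
      (coverNum_mono s (Metric.closedBall_subset_ball (by linarith)))
    · rw [show t * (4 * s * (1 / t)) = 4 * s by field_simp]
      linarith
    · rw [mul_div_cancel₀ _ ht.ne']
  refine le_trans (le_of_eq ?_) (hX.trans (ENat.toENNReal_le.2 hcov))
  rw [Real.mul_rpow (by norm_num) hs0.le]

/-- A choice of arbitrarily small good scales, with goodness up to `k` steps at the `k`-th one, has
a subsequence along which `X` converges to a tangent set. -/
theorem exists_tangent_of_scales (hfin : FiniteCovering x) {P : ℕ → ℝ → Prop}
    (h : ∀ (H : ℕ) (r₀ : ℝ), 0 < r₀ → ∃ r, 0 < r ∧ r < r₀ ∧ P H r) :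
    ∃ T ∈ tangentCone x, ∀ R : ℝ, 0 < R → ∀ ε : ℝ, 0 < ε → ∀ (H : ℕ) (r₀ : ℝ), 0 < r₀ →
      ∃ (k : ℕ) (r : ℝ) (hr : 0 < r), H ≤ k ∧ r < r₀ ∧ P k r ∧
        rescale x r⁻¹ (inv_pos.2 hr) ∈ pGHNhd T R ε := by
  choose r hr0 hr1 hr using fun k : ℕ => h k (1 / ((k : ℝ) + 1)) (by positivity)
  have hlim : Tendsto r atTop (𝓝 0) := squeeze_zero (fun k => (hr0 k).le) (fun k => (hr1 k).le)
    tendsto_one_div_add_atTop_nhds_zero_nat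
  obtain ⟨T, hproper, hT⟩ := exists_limit hfin hr0 hlim
  have hlim' : Tendsto (fun k => (r k)⁻¹) atTop atTop :=
    tendsto_inv_nhdsGT_zero.comp (tendsto_nhdsWithin_iff.2 ⟨hlim, Eventually.of_forall hr0⟩)
  refine ⟨T, ⟨hproper, fun R hR ε hε _ => ?_⟩, fun R hR ε hε H r₀ hr₀ => ?_⟩
  · exact hlim'.frequently ((hT R hR ε hε).mono fun k hk => ⟨inv_pos.2 (hr0 k), hk⟩)
  · obtain ⟨k, hk, hk1, hk2⟩ := ((hT R hR ε hε).and_eventually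
      ((eventually_ge_atTop H).and (hlim.eventually_lt_const hr₀))).exists
    exact ⟨k, r k, hr0 k, hk1, hk2, hr k, hk⟩

/-- Growth at rate `α` from good scales of `X` passes to the limit at these scales. -/
theorem exists_tangent_le_lowerBoxDim (hunif : UniformCovering x) (hfin : FiniteCovering x)
    {α : ℝ} (hα : (α : EReal) < upperTangentialDim x) :
    ∃ T ∈ tangentCone x, α ≤ lowerBoxDim T.pt := by
  obtain ⟨M, hM, hscale⟩ := exists_scale_of_lt_upperTangentialDim hunif hfin hα
  obtain ⟨T, hT, hclose⟩ := exists_tangent_of_scales hfin hscale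
  refine ⟨T, hT, le_trans ?_ (le_iSup (lowerBallDim T.pt) 2)⟩
  have hdyadic : ∀ n : ℕ, ENNReal.ofReal (2 ^ α) ^ n ≤ ENNReal.ofReal M *
      (coverNum ((1 / 2 : ℝ) ^ n / 4) (Metric.ball T.pt 2) : ℕ∞) := by
    intro n
    have hn : (1 / 2 : ℝ) ^ n ≤ 1 := pow_le_one₀ (by norm_num) (by norm_num)
    have hn0 : (0 : ℝ) < (1 / 2) ^ n := by positivity
    obtain ⟨k, r, hr, hnk, -, hk, hTk⟩ :=
      hclose 1 one_pos ((1 / 2 : ℝ) ^ n / 4) (by positivity) n 1 one_pos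
    refine (hk n hnk).trans (mul_le_mul' le_rfl (ENat.toENNReal_le.2 ?_))
    refine (coverNum_le_of_mem_pGHNhd' hTk (r := (1 / 2 : ℝ) ^ n / 4) ?_ ?_).trans
      (coverNum_mono _ (Metric.closedBall_subset_ball (by linarith)))
    · rw [show r⁻¹ * ((1 / 2) ^ n * r) = (1 / 2 : ℝ) ^ n by field_simp]
      linarith
    · rw [inv_mul_cancel₀ hr.ne']
  refine le_liminf_log_div (M := (M * 2 ^ |α|)⁻¹ * 4 ^ (-α)) (by positivity) ?_
  filter_upwards [Ioo_mem_nhdsGT (by norm_num : (0 : ℝ) < 1 / 4)] with l hl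
  have h := rpow_le_of_dyadic
    (f := fun l => ((coverNum (l / 4) (Metric.ball T.pt 2) : ℕ∞) : ℝ≥0∞))
    (fun s t _ hst => coverNum_toENNReal_anti _ (by linarith)) hM hdyadic
    (mul_pos four_pos hl.1) (by linarith [hl.2])
  rw [mul_div_cancel_left₀ l four_ne_zero, Real.mul_rpow (by norm_num) hl.1.le, ← mul_assoc] at h
  exact h

/-- Growth at rate at most `α` from good scales of `X` passes to the limit at these scales. Balls
of radius larger than `1` of the limit cost only a constant factor, by submultiplicativity. -/
theorem exists_tangent_upperBoxDim_le (hunif : UniformCovering x) (hfin : FiniteCovering x)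
    {α : ℝ} (hα : lowerTangentialDim x < α) :
    ∃ T ∈ tangentCone x, upperBoxDim T.pt ≤ α := by
  obtain ⟨M, hM, hscale⟩ := exists_scale_of_lowerTangentialDim_lt hunif hfin hα
  obtain ⟨c, hc, a, ha, hc'⟩ := hunif.exists_nat
  obtain ⟨T, hT, hclose⟩ := exists_tangent_of_scales hfin hscale
  refine ⟨T, hT, iSup_le fun R => ?_⟩
  obtain ⟨j, hj⟩ := pow_unbounded_of_one_lt (2 * R) (by norm_num : (1 : ℝ) < 2)
  obtain ⟨K, r₀, hr₀, hK⟩ := hfin.dyadicCover_le j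
  set A := ENNReal.ofReal (2 ^ α) with hA
  have hj1 : (1 : ℝ) ≤ 2 ^ j := one_le_pow₀ (by norm_num)
  have hj2 : (1 / 2 : ℝ) ^ j * 2 ^ j = 1 := by rw [← mul_pow]; norm_num
  set B : ℝ := c * K * (M * (2 ^ α) ^ 3) with hB
  have hdyadic : ∀ n : ℕ, ((coverNum ((1 / 2 : ℝ) ^ n) (Metric.ball T.pt (2 ^ j / 2)) : ℕ∞) : ℝ≥0∞)
      ≤ ENNReal.ofReal B * A ^ n := by
    intro n
    have hn : (1 / 2 : ℝ) ^ n ≤ 1 := pow_le_one₀ (by norm_num) (by norm_num)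
    have hn0 : (0 : ℝ) < (1 / 2) ^ n := by positivity
    have hn3 : (1 / 2 : ℝ) ^ (n + 3) = (1 / 2) ^ n / 8 := by rw [pow_add]; norm_num; ring
    obtain ⟨k, r, hr, hnk, hrlt, hk, hTk⟩ :=
      hclose (2 ^ j / 2) (by positivity) ((1 / 2 : ℝ) ^ n / 8) (by positivity) (n + 3)
        (min r₀ (a / 2) / 2 ^ j) (by positivity)
    rw [lt_div_iff₀ (by positivity), lt_min_iff, mul_comm] at hrlt
    have hr' : 0 < 2 ^ j * r := by positivity
    have hjr : (1 / 2 : ℝ) ^ j * (2 ^ j * r) = r := by rw [← mul_assoc, hj2, one_mul]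
    have h1 : coverNum ((1 / 2 : ℝ) ^ n) (Metric.ball T.pt (2 ^ j / 2)) ≤
        dyadicCover x (2 ^ j * r) (j + (n + 3)) := by
      refine (coverNum_mono _ Metric.ball_subset_closedBall).trans
        (coverNum_le_of_mem_pGHNhd hTk ?_ ?_)
      · rw [pow_add, hn3, show r⁻¹ * (2 * ((1 / 2 : ℝ) ^ j * ((1 / 2) ^ n / 8) * (2 ^ j * r)))
          = ((1 / 2 : ℝ) ^ j * 2 ^ j) * ((1 / 2) ^ n / 4) * (r⁻¹ * r) by ring, hj2,
          inv_mul_cancel₀ hr.ne']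
        linarith
      · rw [mul_comm (2 ^ j) r, inv_mul_cancel_left₀ hr.ne']
        linarith
    have h2 := dyadicCover_add_le hc hc' hr' (by linarith [hrlt.2]) j (n + 3)
    rw [hjr] at h2
    have h3 : dyadicCover x (2 ^ j * r) (j + (n + 3)) ≤ c * K * dyadicCover x r (n + 3) :=
      h2.trans (by gcongr; exact hK _ hr' hrlt.1)
    have h4 := ENat.toENNReal_le.2 (h1.trans h3)
    simp only [ENat.toENNReal_mul, ENat.toENNReal_coe] at h4
    refine h4.trans ?_
    calc (c : ℝ≥0∞) * K * (dyadicCover x r (n + 3) : ℕ∞)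
        ≤ c * K * (ENNReal.ofReal M * A ^ (n + 3)) := by gcongr; exact hk (n + 3) hnk
      _ = ENNReal.ofReal B * A ^ n := by
        rw [hB, ENNReal.ofReal_mul (by positivity), ENNReal.ofReal_mul (by positivity),
          ENNReal.ofReal_mul hM.le, ENNReal.ofReal_pow (by positivity), ENNReal.ofReal_natCast,
          ENNReal.ofReal_natCast, ← hA, pow_add]
        ring
  refine (upperBallDim_le_of_le T.pt (by linarith : R ≤ 2 ^ j / 2)).trans ?_
  have hB0 : 0 ≤ B := by positivity
  refine limsup_log_div_le (M := (B + 1) * 2 ^ |α|) (by positivity) ?_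
  filter_upwards [eventually_mem_Ioo] with l hl
  refine le_rpow_of_dyadic (M := B + 1)
    (f := fun l => ((coverNum l (Metric.ball T.pt (2 ^ j / 2)) : ℕ∞) : ℝ≥0∞))
    (fun s t _ hst => coverNum_toENNReal_anti _ hst) (by positivity) (fun n => ?_) hl.1 hl.2
  refine (hdyadic n).trans ?_
  gcongr
  linarith

end Tangent

end TangentialDim

/-! ### Comparison of tangential and box dimensions -/

theorem mainTheorem2 {X : Type u} [MetricSpace X] (x : X)
    (hunif : TangentialDim.UniformCovering x) (hfin : TangentialDim.FiniteCovering x) :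
    (TangentialDim.lowerTangentialDim x =
        ⨅ T ∈ TangentialDim.tangentCone x, TangentialDim.lowerBoxDim T.pt) ∧
      (TangentialDim.lowerTangentialDim x =
        ⨅ T ∈ TangentialDim.tangentCone x, TangentialDim.upperBoxDim T.pt) ∧
      (TangentialDim.upperTangentialDim x =
        ⨆ T ∈ TangentialDim.tangentCone x, TangentialDim.lowerBoxDim T.pt) ∧
      (TangentialDim.upperTangentialDim x =
        ⨆ T ∈ TangentialDim.tangentCone x, TangentialDim.upperBoxDim T.pt) := by
  have hinf : ⨅ T ∈ TangentialDim.tangentCone x, TangentialDim.upperBoxDim T.pt ≤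
      TangentialDim.lowerTangentialDim x := by
    refine EReal.le_of_forall_lt_iff_le.1 fun α hα => ?_
    obtain ⟨T, hT, h⟩ := TangentialDim.exists_tangent_upperBoxDim_le hunif hfin hα
    exact (iInf₂_le T hT).trans h
  have hsup : TangentialDim.upperTangentialDim x ≤
      ⨆ T ∈ TangentialDim.tangentCone x, TangentialDim.lowerBoxDim T.pt := by
    refine EReal.ge_of_forall_gt_iff_ge.1 fun α hα => ?_
    obtain ⟨T, hT, h⟩ := TangentialDim.exists_tangent_le_lowerBoxDim hunif hfin hα
    exact h.trans (le_iSup₂_of_le T hT le_rfl)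
  have hinf_le : ⨅ T ∈ TangentialDim.tangentCone x, TangentialDim.lowerBoxDim T.pt ≤
      ⨅ T ∈ TangentialDim.tangentCone x, TangentialDim.upperBoxDim T.pt :=
    iInf₂_mono fun T _ => TangentialDim.lowerBoxDim_le_upperBoxDim T.pt
  have hsup_le : ⨆ T ∈ TangentialDim.tangentCone x, TangentialDim.lowerBoxDim T.pt ≤
      ⨆ T ∈ TangentialDim.tangentCone x, TangentialDim.upperBoxDim T.pt :=
    iSup₂_mono fun T _ => TangentialDim.lowerBoxDim_le_upperBoxDim T.pt
  have hlow : TangentialDim.lowerTangentialDim x ≤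
      ⨅ T ∈ TangentialDim.tangentCone x, TangentialDim.lowerBoxDim T.pt :=
    le_iInf₂ fun T hT => TangentialDim.lowerTangentialDim_le_lowerBoxDim hT
  have hupp : ⨆ T ∈ TangentialDim.tangentCone x, TangentialDim.upperBoxDim T.pt ≤
      TangentialDim.upperTangentialDim x :=
    iSup₂_le fun T hT => TangentialDim.upperBoxDim_le_upperTangentialDim hT
  exact ⟨le_antisymm hlow (hinf_le.trans hinf), le_antisymm (hlow.trans hinf_le) hinf,
    le_antisymm hsup (hsup_le.trans hupp), le_antisymm (hsup.trans hsup_le) hupp⟩
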